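/- **Setting.** Let $\Delta$ be a finite ranked alphabet and $N$ a finite set of nonterminals (all of arity $0$). A regular tree grammar $G=(S,N,\Delta,P)$ has a start symbol $S\in N$ and a finite list $P$ of productions $X\to\alpha$ with $X\in N$ and $\alpha$ a term over $\Delta\cup N$; $L(G)\subseteq T_\Delta$ is its language, and $\mathsf{depth}_G(e)\in\mathbb N\cup\{\infty\}$ is the minimum, over all parse trees of $e$ from $S$, of the maximum number of nonterminals on a root-to-leaf path (with $\min\emptyset=\infty$). Fix a base language: a regular tree grammar $G'=(S',N',\Delta,P')$ with $N'\subseteq N$, a set $\mathcal M$ of (finitely encoded) examples, and a predicate $\mathsf{consistent}\subseteq L(G')\times\mathcal M$. Assume that its semantics on fixed examples is computable by tree automata: from $M\in\mathcal M$ one can compute tree automata $A_M$ and $A_{\neg M}$ with $L(A_M)=\{e\in L(G'):\mathsf{consistent}(e,M)\}$ and $L(A_{\neg M})=\{e\in L(G'):\neg\,\mathsf{consistent}(e,M)\}$. For a finite $X\subseteq\mathcal M$, $\mathsf{solves}(e,X)$ means that $e\in L(G')$ and $\mathsf{consistent}(e,M)$ for all $M\in X$. A learning instance is a pair $I=(X,Y)$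 of finite sets of training and testing examples; $e$ solves $I$ if $\mathsf{solves}(e,X\cup Y)$, and $e$ is non-generalizing on $I$ if $\mathsf{solves}(e,X)$ holds and $\mathsf{solves}(e,Y)$ does not. For $G=(S,N,\Delta,P)$ let $\mathsf{extend}(G,G')=(S,N,\Delta,P\cup P')$. A grammar $H$ is adequate for $I_1,\dots,I_l$ if for every $p$ some $e\in L(H)$ solves $I_p$; it is generalizing for the depth ordering if it is adequate and for every $p$ there is $e\in L(H)$ that solves $I_p$ and satisfies $\mathsf{depth}_H(e)\le\mathsf{depth}_H(e')$ for all $e'\in L(H)$ that are non-generalizing on $I_p$. Grammars are encoded as trees over the alphabet $\Gamma(\Delta,N)=\Delta\sqcup\{\mathsf{root}^1,\mathsf{end}^0\}\sqcup\{\mathsf{lhs}_X^2,\mathsf{rhs}_X^0: X\in N\}$: if $P=\langle X_1\to\alpha_1,\dots,X_s\to\alpha_s\rangle$, then $\mathsf{enc}(G)=\mathsf{root}(\mathsf{lhs}_{X_1}(\hat\alpha_1,\mathsf{lhs}_{X_2}(\hat\alpha_2,\dots\mathsf{lhs}_{X_s}(\hat\alpha_s,\mathsf{end})\dots)))$, where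 $\hat\alpha$ is $\alpha$ with each nonterminal $X$ replaced by $\mathsf{rhs}_X$. By convention $s\ge 1$ and the start symbol is that of the topmost production, $S=X_1$, so that $\mathsf{enc}(G)$ determines $G$. Given instances $I_1,\dots,I_l$ and a meta-grammar $\mathcal G$ (a regular tree grammar over $\Gamma(\Delta,N)$), a *solution* of DSL synthesis is a grammar $G=(S,N,\Delta,P)$ such that $\mathsf{extend}(G,G')$ is adequate and generalizing for $I_1,\dots,I_l$ with the depth ordering, and $\mathsf{enc}(G)\in L(\mathcal G)$. **Theorem.** For every such base language, DSL synthesis with the depth ordering is decidable: there is an algorithm that, given $I_1,\dots,I_l$ and $\mathcal G$, decides whether a solution exists, and there is an algorithm that outputs a solution if one exists and reports that there is none otherwise. Furthermore, for every input $I_1,\dots,I_l,\mathcal G$, the set $\{\mathsf{enc}(G): G \text{ is a solution}\}$ is a regular set of trees over $\Gamma(\Delta,N)$. -/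

import Mathlib

namespace DSLSynth

universe u v w

/-! ## Ranked alphabets and terms -/

/-- The set `T_σ` of finite terms (trees) over the ranked alphabet `σ` with arity function `ar`. -/
inductive Term {σ : Type u} (ar : σ → ℕ) : Type u
  | node (f : σ) (ts : Fin (ar f) → Term ar) : Term ar

/-- The arity function of the alphabet `σ ⊔ ν`, where the symbols of `ν` (nonterminals) are nullary. -/
abbrev withNullary {σ : Type u} (ar : σ → ℕ) (ν : Type v) : σ ⊕ ν → ℕ :=
  Sum.elim ar fun _ => 0

/-! ### Terms as data for algorithms

A term is coded by its word in Polish (prefix) notation. -/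

/-- The arity function is primitive recursive (automatic over a finite alphabet). -/
class PrimArity {σ : Type u} [Primcodable σ] (ar : σ → ℕ) : Prop where
  out : Primrec ar

instance {σ : Type u} [Primcodable σ] [Finite σ] (ar : σ → ℕ) : PrimArity ar :=
  ⟨Primrec.dom_finite ar⟩

theorem primrec_withNullary {σ : Type u} {ν : Type v} [Primcodable σ] [Primcodable ν]
    {ar : σ → ℕ} (h : Primrec ar) : Primrec (withNullary ar ν) := by
  have h1 : Primrec fun s : σ ⊕ ν => Sum.casesOn (motive := fun _ => ℕ) s ar fun _ => 0 :=
    Primrec.sumCasesOn Primrec.id (h.comp Primrec.snd).to₂ (Primrec.const 0).to₂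
  exact h1.of_eq fun s => by cases s <;> rfl

instance {σ : Type u} {ν : Type v} [Primcodable σ] [Primcodable ν] (ar : σ → ℕ) [PrimArity ar] :
    PrimArity (withNullary ar ν) :=
  ⟨primrec_withNullary PrimArity.out⟩

namespace Term

variable {σ : Type u} {ar : σ → ℕ}

/-- Polish notation of a term. -/
def toWord : Term ar → List σ
  | node f ts => f :: (List.ofFn fun i => toWord (ts i)).flatten

/-- One step of the right-to-left stack parser of Polish notation. -/
def push (f : σ) (st : List (Term ar)) : Option (List (Term ar)) :=
  if h : ar f ≤ st.length then
    some (node f (fun i => st[i.1]'(lt_of_lt_of_le i.2 h)) :: st.drop (ar f))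
  else none

/-- The right-to-left stack parser of Polish notation. -/
def parse : List σ → Option (List (Term ar))
  | [] => some []
  | f :: w => (parse w).bind (push f)

/-- The number of terms on the parser's stack, computed from arities only. -/
def stackSize (ar : σ → ℕ) (w : List σ) : Option ℕ :=
  w.foldr (fun f o => o.bind fun n => if ar f ≤ n then some (n - ar f + 1) else none) (some 0)

theorem map_length_parse (w : List σ) :
    (parse (ar := ar) w).map List.length = stackSize ar w := by
  induction w with
  | nil => rfl
  | cons f w ih =>
    have e : stackSize ar (f :: w) =
        (stackSize ar w).bind fun n => if ar f ≤ n then some (n - ar f + 1) else none := rfl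
    rw [e, ← ih]
    cases h : parse (ar := ar) w with
    | none => simp [parse, h]
    | some st =>
      simp only [parse, h, Option.bind_some, Option.map_some, push]
      split_ifs <;> simp

theorem flatten_of_parse (w : List σ) (st : List (Term ar)) (h : parse w = some st) :
    (st.map toWord).flatten = w := by
  induction w generalizing st with
  | nil => simp [parse] at h; subst h; rfl
  | cons f w ih =>
    cases h' : parse (ar := ar) w with
    | none => simp [parse, h'] at h
    | some st' =>
      simp only [parse, h', Option.bind_some, push] at h
      split_ifs at h with hl
      have h2 := Option.some.inj h
      rw [← h2, ← ih st' h']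
      have e : (List.ofFn fun i : Fin (ar f) =>
          toWord (st'[i.1]'(lt_of_lt_of_le i.2 hl))) = (st'.take (ar f)).map toWord := by
        apply List.ext_getElem
        · simp [hl]
        · intro i h1 h2; simp
      simp only [List.map_cons, List.flatten_cons, toWord, e, List.cons_append]
      rw [← List.flatten_append, ← List.map_append, List.take_append_drop]

theorem parse_toWord_append (t : Term ar) (w : List σ) (st : List (Term ar))
    (h : parse w = some st) : parse (toWord t ++ w) = some (t :: st) := by
  induction t generalizing w st with
  | node f ts ih =>
    have key : ∀ l : List (Term ar), (∀ t ∈ l, ∀ w st, parse w = some st →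
        parse (toWord t ++ w) = some (t :: st)) →
        parse ((l.map toWord).flatten ++ w) = some (l ++ st) := by
      intro l
      induction l with
      | nil => intro _; simpa using h
      | cons a l ihl =>
        intro H
        simp only [List.map_cons, List.flatten_cons, List.append_assoc, List.cons_append]
        exact H a (by simp) _ _ (ihl fun t ht => H t (by simp [ht]))
    have k := key (List.ofFn ts) (by
      intro t ht w st hw
      obtain ⟨i, rfl⟩ := (List.mem_ofFn' _ _).1 ht
      exact ih i w st hw)
    have e : (List.ofFn fun i => toWord (ts i)) = (List.ofFn ts).map toWord := by
      rw [List.map_ofFn]; rfl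
    simp only [toWord, e, List.cons_append, parse, k, Option.bind_some, push]
    simp

/-- Terms correspond to the words that the parser reduces to a single term. -/
def wordEquiv (ar : σ → ℕ) : Term ar ≃ {w : List σ // stackSize ar w = some 1} where
  toFun t := ⟨toWord t, by
    have h := parse_toWord_append t [] [] rfl
    rw [← map_length_parse, ← List.append_nil (toWord t), h]; rfl⟩
  invFun w := ((parse (ar := ar) w.1).get (by
      have h := map_length_parse (ar := ar) w.1
      rw [w.2] at h
      cases h' : parse (ar := ar) w.1 <;> simp_all)).head (by
      have h := map_length_parse (ar := ar) w.1
      rw [w.2] at h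
      intro h0
      cases h' : parse (ar := ar) w.1 <;> simp_all)
  left_inv t := by
    have h := parse_toWord_append t [] [] rfl
    rw [List.append_nil] at h
    simp [h]
  right_inv w := by
    obtain ⟨w, hw⟩ := w
    have h := map_length_parse (ar := ar) w
    rw [hw] at h
    cases h' : parse (ar := ar) w with
    | none => simp [h'] at h
    | some st =>
      rw [h', Option.map_some, Option.some.injEq] at h
      obtain ⟨t, rfl⟩ := List.length_eq_one_iff.1 h
      have := flatten_of_parse w [t] h'
      apply Subtype.ext
      simpa [h'] using this

theorem primrecPred_stackSize [Primcodable σ] (h : Primrec ar) :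
    PrimrecPred fun w : List σ => stackSize ar w = some 1 := by
  have h1 : Primrec₂ fun (p : σ × Option ℕ) (n : ℕ) =>
      if ar p.1 ≤ n then some (n - ar p.1 + 1) else none := by
    have ha : Primrec fun q : (σ × Option ℕ) × ℕ => ar q.1.1 :=
      h.comp (Primrec.fst.comp Primrec.fst)
    refine Primrec.ite (Primrec.nat_le.comp ha Primrec.snd) ?_ (Primrec.const none)
    exact Primrec.option_some.comp (Primrec.succ.comp (Primrec.nat_sub.comp Primrec.snd ha))
  have h2 : Primrec fun p : σ × Option ℕ =>
      p.2.bind fun n => if ar p.1 ≤ n then some (n - ar p.1 + 1) else none :=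
    Primrec.option_bind Primrec.snd h1
  have h3 : Primrec fun w : List σ => stackSize ar w :=
    Primrec.list_foldr Primrec.id (Primrec.const (some 0)) (h2.comp Primrec.snd).to₂
  exact Primrec.eq.comp h3 (Primrec.const (some 1))

instance [Primcodable σ] [h : PrimArity ar] : Primcodable (Term ar) :=
  letI := Primcodable.subtype (primrecPred_stackSize h.out)
  Primcodable.ofEquiv _ (wordEquiv ar)

end Term

/-! ## Tree automata -/

/-- A nondeterministic top-down tree automaton over the ranked alphabet `σ`. The states are natural
numbers, of which only finitely many occur. A transition `(q, f, [q₁, …, qᵣ])` lets the automaton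
read the symbol `f` in state `q` and send `q₁, …, qᵣ` to the children. -/
structure TreeAutomaton (σ : Type u) where
  init : List ℕ
  trans : List (ℕ × σ × List ℕ)

namespace TreeAutomaton

/-- The automaton has an accepting run on the term from the state `q`. -/
def AcceptsFrom {σ : Type u} {ar : σ → ℕ} (A : TreeAutomaton σ) : Term ar → ℕ → Prop
  | .node f ts, q => ∃ qs : Fin (ar f) → ℕ,
      (q, f, List.ofFn qs) ∈ A.trans ∧ ∀ i, A.AcceptsFrom (ts i) (qs i)

/-- The set of terms accepted by the automaton. -/
def language {σ : Type u} (A : TreeAutomaton σ) (ar : σ → ℕ) : Set (Term ar) :=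
  {t | ∃ q ∈ A.init, A.AcceptsFrom t q}

def equivProd (σ : Type u) : TreeAutomaton σ ≃ List ℕ × List (ℕ × σ × List ℕ) where
  toFun A := (A.init, A.trans)
  invFun p := ⟨p.1, p.2⟩
  left_inv _ := rfl
  right_inv _ := rfl

instance {σ : Type u} [Primcodable σ] : Primcodable (TreeAutomaton σ) :=
  Primcodable.ofEquiv _ (equivProd σ)

end TreeAutomaton

/-- A regular set of trees. -/
def IsRegularTreeSet {σ : Type u} {ar : σ → ℕ} (L : Set (Term ar)) : Prop :=
  ∃ A : TreeAutomaton σ, A.language ar = L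

/-! ## Regular tree grammars -/

/-- A regular tree grammar over the ranked alphabet `σ` with nonterminals from `ν`. The finitely many
productions are given as a list; their right-hand sides are terms over `σ ⊔ ν`. -/
structure TreeGrammar {σ : Type u} (ar : σ → ℕ) (ν : Type v) where
  start : ν
  prods : List (ν × Term (withNullary ar ν))

namespace TreeGrammar

variable {σ : Type u} {ar : σ → ℕ} {ν : Type v}

def equivProd (ar : σ → ℕ) (ν : Type v) :
    TreeGrammar ar ν ≃ ν × List (ν × Term (withNullary ar ν)) where
  toFun G := (G.start, G.prods)
  invFun p := ⟨p.1, p.2⟩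
  left_inv _ := rfl
  right_inv _ := rfl

instance [Primcodable σ] [PrimArity ar] [Primcodable ν] : Primcodable (TreeGrammar ar ν) :=
  Primcodable.ofEquiv _ (equivProd ar ν)

/-- `G.ParseTree α e` is the type of parse trees of the term `e` from the sentential form `α`:
symbols of the alphabet are read as they stand, and a nonterminal is expanded by a production. -/
inductive ParseTree (G : TreeGrammar ar ν) : Term (withNullary ar ν) → Term ar → Type (max u v)
  | sym (f : σ) (αs : Fin (ar f) → Term (withNullary ar ν)) (es : Fin (ar f) → Term ar)
      (ps : ∀ i, ParseTree G (αs i) (es i)) :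
      ParseTree G (.node (.inl f) αs) (.node f es)
  | expand (X : ν) (ts : Fin 0 → Term (withNullary ar ν)) (α : Term (withNullary ar ν))
      (e : Term ar) (h : (X, α) ∈ G.prods) (p : ParseTree G α e) :
      ParseTree G (.node (.inr X) ts) e

/-- The maximum number of nonterminals on a root-to-leaf path of a parse tree. -/
def ParseTree.depth {G : TreeGrammar ar ν} :
    {α : Term (withNullary ar ν)} → {e : Term ar} → G.ParseTree α e → ℕ
  | _, _, .sym _ _ _ ps => Finset.univ.sup fun i => (ps i).depth
  | _, _, .expand _ _ _ _ _ p => p.depth + 1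

/-- The sentential form that consists of a single nonterminal. -/
def nt (ar : σ → ℕ) (X : ν) : Term (withNullary ar ν) :=
  .node (.inr X) Fin.elim0

/-- The language `L(G)`: the terms that have a parse tree from the starting nonterminal. -/
def language (G : TreeGrammar ar ν) : Set (Term ar) :=
  {e | Nonempty (G.ParseTree (nt ar G.start) e)}

/-- The depth complexity `depth_G(e)`: the minimal depth of a parse tree of `e`, and `∞` if there is
no parse tree. -/
noncomputable def depth (G : TreeGrammar ar ν) (e : Term ar) : ℕ∞ :=
  ⨅ p : G.ParseTree (nt ar G.start) e, (p.depth : ℕ∞)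

/-- The depth expression ordering `e ≤_G e'`. -/
def depthLE (G : TreeGrammar ar ν) (e e' : Term ar) : Prop :=
  G.depth e ≤ G.depth e'

/-- `extend(G, G')`: the starting nonterminal of `G` and the productions of both grammars. -/
def extend (G G' : TreeGrammar ar ν) : TreeGrammar ar ν :=
  ⟨G.start, G.prods ++ G'.prods⟩

end TreeGrammar

/-! ## Grammar trees -/

/-- The grammar alphabet `Γ(Δ, N)` for grammars all of whose nonterminals have arity `0`. -/
inductive GSym (Δ : Type u) (N : Type v) : Type (max u v)
  | base (f : Δ)
  | root
  | fin
  | lhs (X : N)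
  | rhs (X : N)

namespace GSym

/-- Arities in the grammar alphabet. -/
def arity {Δ : Type u} (ar : Δ → ℕ) (N : Type v) : GSym Δ N → ℕ
  | base f => ar f
  | root => 1
  | fin => 0
  | lhs _ => 2
  | rhs _ => 0

def equivSum (Δ : Type u) (N : Type v) : GSym Δ N ≃ (Δ ⊕ Bool) ⊕ (N ⊕ N) where
  toFun
    | base f => .inl (.inl f)
    | root => .inl (.inr true)
    | fin => .inl (.inr false)
    | lhs X => .inr (.inl X)
    | rhs X => .inr (.inr X)
  invFun
    | .inl (.inl f) => base f
    | .inl (.inr true) => root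
    | .inl (.inr false) => fin
    | .inr (.inl X) => lhs X
    | .inr (.inr X) => rhs X
  left_inv s := by cases s <;> rfl
  right_inv s := by rcases s with (f | (_ | _)) | (X | X) <;> rfl

instance {Δ : Type u} {N : Type v} [Primcodable Δ] [Primcodable N] : Primcodable (GSym Δ N) :=
  Primcodable.ofEquiv _ (equivSum Δ N)

instance {Δ : Type u} {N : Type v} [Finite Δ] [Finite N] : Finite (GSym Δ N) :=
  Finite.of_equiv _ (equivSum Δ N).symm

end GSym

section Encoding

variable {Δ : Type u} {ar : Δ → ℕ} {N : Type v}

/-- Trees over the grammar alphabet. -/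
abbrev GTree (ar : Δ → ℕ) (N : Type v) : Type (max u v) := Term (GSym.arity ar N)

/-- Encoding of the right-hand side of a production. -/
def encTerm : Term (withNullary ar N) → GTree ar N
  | .node (.inl f) ts => .node (.base f) fun i : Fin (ar f) => encTerm (ts i)
  | .node (.inr X) _ => .node (.rhs X) Fin.elim0

/-- Encoding of a list of productions as a right-going spine. -/
def encProds : List (N × Term (withNullary ar N)) → GTree ar N
  | [] => .node .fin Fin.elim0
  | (X, α) :: l => .node (.lhs X) ![encTerm α, encProds l]

/-- The grammar tree `enc(G)`. -/
def TreeGrammar.enc (G : TreeGrammar ar N) : GTree ar N :=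
  .node .root ![encProds G.prods]

/-- The starting nonterminal is that of the first (topmost) production. This is the convention under
which a grammar tree determines the grammar that it encodes. -/
def TreeGrammar.StartsOnTop (G : TreeGrammar ar N) : Prop :=
  G.prods.head?.map Prod.fst = some G.start

end Encoding

/-! ## Base languages, learning instances, and DSL synthesis -/

/-- A base language: a regular tree grammar (its nonterminals may be just some of those in `N`), a
type `M` of examples, and the consistency relation, which is meaningful for, and only used on,
expressions in the language of the grammar. -/
structure BaseLanguage {Δ : Type u} (ar : Δ → ℕ) (N : Type v) (M : Type w) where
  grammar : TreeGrammar ar N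
  consistent : Term ar → M → Prop

/-- A learning instance: finite sets (given as lists) of training and of testing examples. -/
structure LearningInstance (M : Type w) where
  train : List M
  test : List M

def LearningInstance.equivProd (M : Type w) : LearningInstance M ≃ List M × List M where
  toFun I := (I.train, I.test)
  invFun p := ⟨p.1, p.2⟩
  left_inv _ := rfl
  right_inv _ := rfl

instance {M : Type w} [Primcodable M] : Primcodable (LearningInstance M) :=
  Primcodable.ofEquiv _ (LearningInstance.equivProd M)

namespace BaseLanguage

variable {Δ : Type u} {ar : Δ → ℕ} {N : Type v} {M : Type w}

/-- `e` is an expression of the base language that is consistent with every example in `X`. -/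
def SolvesSet (B : BaseLanguage ar N M) (e : Term ar) (X : List M) : Prop :=
  e ∈ B.grammar.language ∧ ∀ m ∈ X, B.consistent e m

/-- `e` solves the learning instance: it is consistent with training and testing examples. -/
def Solves (B : BaseLanguage ar N M) (e : Term ar) (I : LearningInstance M) : Prop :=
  B.SolvesSet e (I.train ++ I.test)

/-- `e` is non-generalizing: it is consistent with the training but not the testing examples. -/
def NonGeneralizing (B : BaseLanguage ar N M) (e : Term ar) (I : LearningInstance M) : Prop :=
  B.SolvesSet e I.train ∧ ¬ B.SolvesSet e I.test

/-- Every instance is solved by an expression of the DSL. -/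
def Adequate (B : BaseLanguage ar N M) (H : TreeGrammar ar N)
    (Is : List (LearningInstance M)) : Prop :=
  ∀ I ∈ Is, ∃ e ∈ H.language, B.Solves e I

/-- The DSL is generalizing for the expression ordering `le`. -/
def Generalizing (B : BaseLanguage ar N M) (H : TreeGrammar ar N)
    (le : Term ar → Term ar → Prop) (Is : List (LearningInstance M)) : Prop :=
  B.Adequate H Is ∧
    ∀ I ∈ Is, ∃ e ∈ H.language, B.Solves e I ∧
      ∀ e' ∈ H.language, B.NonGeneralizing e' I → le e e'

/-- The semantics on fixed examples can be evaluated by tree automata, which can be computed from the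
example. -/
def TreeAutomatonComputable [Primcodable Δ] [Primcodable M] (B : BaseLanguage ar N M) : Prop :=
  ∃ A Aneg : M → TreeAutomaton Δ, Computable A ∧ Computable Aneg ∧
    ∀ m, (A m).language ar = {e | e ∈ B.grammar.language ∧ B.consistent e m} ∧
      (Aneg m).language ar = {e | e ∈ B.grammar.language ∧ ¬ B.consistent e m}

end BaseLanguage

/-- An input of DSL synthesis: learning instances and a meta-grammar, i.e. a regular tree grammar
over the grammar alphabet (with nonterminals named by natural numbers). -/
abbrev SynthesisInput {Δ : Type u} (ar : Δ → ℕ) (N : Type v) (M : Type w) : Type (max u v w) :=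
  List (LearningInstance M) × TreeGrammar (GSym.arity ar N) ℕ

/-- `G` is a solution of DSL synthesis with the depth ordering on the given input. -/
def IsSolution {Δ : Type u} {ar : Δ → ℕ} {N : Type v} {M : Type w} (B : BaseLanguage ar N M)
    (inp : SynthesisInput ar N M) (G : TreeGrammar ar N) : Prop :=
  G.StartsOnTop ∧
  B.Generalizing (G.extend B.grammar) (G.extend B.grammar).depthLE inp.1 ∧
  G.enc ∈ inp.2.language

end DSLSynth

open DSLSynth

/-! Choose a congruence of finite index on expressions that saturates `L(G')` and the languages of
the automata for all given examples. Whether an expression solves an instance or is non-generalizing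
on it depends only on its class. A grammar generalizes on an instance iff, for some `d`, an
expression of depth at most `d + 1` solves it and every expression of depth at most `d` that fits
the training examples also fits the testing ones (`isSolution_iff`). The classes derivable from each
nonterminal at depth at most `d` arise from empty sets by applying `d` times an operator that the
productions determine (`TreeGrammar.values_succ`). So being a solution depends only on this
operator, the start symbol and membership of the encoding in the language of the meta-grammar
(`IsAutomataSolution.congr`).

There are finitely many such operators, and the operator of a grammar is computed bottom-up along
its encoding (`isCongr_attr`). Hence the encodings of solutions are saturated by a congruence of
finite index on grammar trees (`exists_isCongr_solutions`) and form a regular set.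

For the algorithms, the index is bounded by an explicit primitive recursive function of the input.
Every class contains a tree of height at most the index, so if there is a solution, there is one of
bounded size (`IsAutomataSolution.exists_small`), and it suffices to test finitely many grammars. A
single grammar can be tested because the chain of derivable classes becomes stationary after a known
number of steps, which bounds `d` (`exists_generalizesAt_iff`). The search is primitive recursive
and works with terms in Polish notation; the passage from examples to automata is computable by
assumption. -/

namespace DSLSynth

universe u v w

/-! ### Congruences on terms -/

section Congruences

variable {σ : Type u} {ar : σ → ℕ} {β : Type v}

/-- The kernel of `v` is a congruence on terms. -/
def IsCongr (v : Term ar → β) : Prop :=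
  ∀ (f : σ) (ts ts' : Fin (ar f) → Term ar), (∀ i, v (ts i) = v (ts' i)) →
    v (.node f ts) = v (.node f ts')

/-- The set `L` is a union of classes of the kernel of `v`. -/
def Saturates (v : Term ar → β) (L : Set (Term ar)) : Prop :=
  ∀ t t', v t = v t' → (t ∈ L ↔ t' ∈ L)

theorem IsCongr.prodMk {γ : Type w} {v : Term ar → β} {v' : Term ar → γ} (h : IsCongr v)
    (h' : IsCongr v') : IsCongr fun t => (v t, v' t) := fun f ts ts' e =>
  Prod.ext (h f ts ts' fun i => (Prod.ext_iff.1 (e i)).1)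
    (h' f ts ts' fun i => (Prod.ext_iff.1 (e i)).2)

theorem IsCongr.comp_injective {γ : Type w} {v : Term ar → β} (h : IsCongr v) {g : β → γ}
    (hg : g.Injective) : IsCongr fun t => g (v t) := fun f ts ts' e =>
  congrArg g (h f ts ts' fun i => hg (e i))

theorem Saturates.comp_injective {γ : Type w} {v : Term ar → β} {L : Set (Term ar)}
    (h : Saturates v L) {g : β → γ} (hg : g.Injective) : Saturates (fun t => g (v t)) L :=
  fun t t' e => h t t' (hg e)

/-- A saturated set of a congruence of finite index is regular. -/
theorem isRegularTreeSet_of_isCongr [Finite σ] {k : ℕ} {v : Term ar → Fin k} (hv : IsCongr v)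
    {L : Set (Term ar)} (hL : Saturates v L) : IsRegularTreeSet L := by
  classical
  -- The states are the classes, and the transitions are those realized by actual terms. Finiteness
  -- of the alphabet makes them finite in number.
  have hS : {p : ℕ × σ × List ℕ | ∃ ts : Fin (ar p.2.1) → Term ar,
      p.1 = (v (.node p.2.1 ts)).1 ∧ p.2.2 = List.ofFn fun i => (v (ts i)).1}.Finite := by
    refine (Set.finite_range fun p : Fin k × (f : σ) × (Fin (ar f) → Fin k) =>
      (p.1.1, p.2.1, List.ofFn fun i => (p.2.2 i).1)).subset ?_
    rintro ⟨q, f, l⟩ ⟨ts, h1, h2⟩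
    exact ⟨⟨v (.node f ts), f, fun i => v (ts i)⟩, Prod.ext h1.symm (Prod.ext rfl h2.symm)⟩
  have hI : ((fun t => (v t).1) '' L).Finite :=
    (Set.finite_range Fin.val).subset (by rintro _ ⟨t, _, rfl⟩; exact ⟨_, rfl⟩)
  obtain ⟨A, hi, ht⟩ : ∃ A : TreeAutomaton σ, (∀ q, q ∈ A.init ↔ ∃ t ∈ L, (v t).1 = q) ∧
      ∀ q f l, (q, f, l) ∈ A.trans ↔ ∃ ts : Fin (ar f) → Term ar,
        q = (v (.node f ts)).1 ∧ l = List.ofFn fun i => (v (ts i)).1 :=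
    ⟨⟨hI.toFinset.toList, hS.toFinset.toList⟩, by simp, by simp⟩
  -- Read bottom-up, the automaton is deterministic: the only state from which `t` is accepted is
  -- its own class.
  have key : ∀ (t : Term ar) (q : ℕ), A.AcceptsFrom t q ↔ q = (v t).1 := by
    intro t
    induction t with
    | node f ts ih =>
      intro q
      constructor
      · rintro ⟨qs, hq, hqs⟩
        obtain ⟨ts', rfl, h⟩ := (ht _ _ _).1 hq
        have h5 := List.ofFn_injective h
        refine congrArg Fin.val (hv _ _ _ fun i => Fin.ext ?_)
        rw [← (ih i _).1 (hqs i), h5]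
      · rintro rfl
        exact ⟨fun i => (v (ts i)).1, (ht _ _ _).2 ⟨ts, rfl, rfl⟩, fun i => (ih i _).2 rfl⟩
  refine ⟨A, Set.ext fun t => ?_⟩
  simp only [TreeAutomaton.language, Set.mem_ofPred_eq, key, exists_eq_right, hi]
  exact ⟨fun ⟨t', ht', h⟩ => (hL t' t (Fin.ext h)).1 ht', fun h => ⟨t, h, rfl⟩⟩

end Congruences

/-- An increasing chain of subsets of a finite set, each of which determines the next one, becomes
stationary after as many steps as the set has elements. -/
theorem chain_subset_of_ncard_le {α : Type u} {R : ℕ → Set α} {S : Set α} (hS : S.Finite) {k : ℕ}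
    (hk : S.ncard ≤ k) (hR : ∀ n, R n ⊆ S) (hm : ∀ n, R n ⊆ R (n + 1))
    (hstep : ∀ n, R n = R (n + 1) → R (n + 1) = R (n + 2)) (n : ℕ) : R n ⊆ R k := by
  have hmono : Monotone R := monotone_nat_of_le_succ hm
  have stat : ∀ m, R m = R (m + 1) → ∀ j, R (m + j) = R m ∧ R (m + j + 1) = R m := by
    intro m h j
    induction j with
    | zero => exact ⟨rfl, h.symm⟩
    | succ j ih =>
      refine ⟨ih.2, ?_⟩
      have := hstep (m + j) (ih.1.trans ih.2.symm)
      exact this.symm.trans ih.2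
  -- While the chain is not stationary, every step adds at least one element.
  have grow : ∀ m, (∀ i < m, R i ≠ R (i + 1)) → m ≤ (R m).ncard := by
    intro m
    induction m with
    | zero => simp
    | succ m ih =>
      intro h
      have h1 := ih fun i hi => h i (by omega)
      have h2 := Set.ncard_lt_ncard ((hm m).ssubset_of_ne (h m (by omega)))
        (hS.subset (hR (m + 1)))
      omega
  by_cases h : ∃ m ≤ k, R m = R (m + 1)
  · obtain ⟨m, hmk, h⟩ := h
    rcases le_total n m with h1 | h1
    · exact hmono (h1.trans hmk)
    · obtain ⟨j, rfl⟩ := Nat.exists_eq_add_of_le h1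
      rw [(stat m h j).1]
      exact hmono hmk
  · push Not at h
    have h1 := grow (k + 1) fun i hi => h i (by omega)
    have h2 := Set.ncard_le_ncard (hR (k + 1)) hS
    omega

/-! ### Height, size and subterms of terms -/

namespace Term

variable {σ : Type u} {ar : σ → ℕ} {β : Type v}

/-- The number of symbols on every path of the term is at most `n`. -/
def HeightLE : ℕ → Term ar → Prop
  | 0, _ => False
  | n + 1, node _ ts => ∀ i, HeightLE n (ts i)

theorem HeightLE.succ {n : ℕ} {t : Term ar} (h : HeightLE n t) : HeightLE (n + 1) t := by
  induction n generalizing t with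
  | zero => exact h.elim
  | succ n ih => cases t with | node f ts => exact fun i => ih (h i)

theorem HeightLE.mono {m n : ℕ} (hmn : m ≤ n) {t : Term ar} (h : HeightLE m t) :
    HeightLE n t := by
  induction hmn with
  | refl => exact h
  | step _ ih => exact ih.succ

theorem exists_heightLE (t : Term ar) : ∃ n, HeightLE n t := by
  induction t with
  | node f ts ih =>
    choose n hn using ih
    exact ⟨Finset.univ.sup n + 1, fun i => (hn i).mono (Finset.le_sup (Finset.mem_univ i))⟩

/-- Every class of a congruence of finite index contains a term of bounded height. -/
theorem exists_heightLE_of_isCongr {k : ℕ} {v : Term ar → Fin k} (hv : IsCongr v) (t : Term ar) :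
    ∃ t', v t' = v t ∧ HeightLE k t' := by
  obtain ⟨n, hn⟩ := exists_heightLE t
  have hsucc : ∀ n, ∀ q, (∃ t, v t = q ∧ HeightLE (n + 1) t) ↔
      ∃ (f : σ) (ts : Fin (ar f) → Term ar), v (node f ts) = q ∧
        ∀ i, v (ts i) ∈ {q | ∃ t, v t = q ∧ HeightLE n t} := by
    intro n q
    constructor
    · rintro ⟨⟨f, ts⟩, h1, h2⟩
      exact ⟨f, ts, h1, fun i => ⟨ts i, rfl, h2 i⟩⟩
    · rintro ⟨f, ts, h1, h2⟩
      choose ts' h3 h4 using h2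
      exact ⟨node f ts', (hv f ts' ts h3).trans h1, h4⟩
  -- By `hsucc` the classes with a representative of height at most `n` determine those for `n + 1`.
  -- There are at most `k` classes, so nothing new appears after `k` steps.
  have := chain_subset_of_ncard_le (R := fun n => {q | ∃ t, v t = q ∧ HeightLE n t})
    (S := Set.univ) Set.finite_univ (k := k) (by simp [Set.ncard_univ]) (fun _ => Set.subset_univ _)
    (fun n q ⟨t, h1, h2⟩ => ⟨t, h1, h2.succ⟩)
    (fun n h => by
      ext q
      simp only [Set.mem_ofPred_eq]
      rw [hsucc, hsucc, h]) n
  exact this ⟨t, rfl, hn⟩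

/-- A bound on the number of symbols of a term of height at most `n` with arities at most `r`. -/
def sizeBound (r : ℕ) : ℕ → ℕ
  | 0 => 0
  | n + 1 => r * sizeBound r n + 1

theorem HeightLE.length_toWord_le {r : ℕ} (hr : ∀ f, ar f ≤ r) {n : ℕ} {t : Term ar}
    (h : HeightLE n t) : (toWord t).length ≤ sizeBound r n := by
  induction n generalizing t with
  | zero => exact h.elim
  | succ n ih =>
    cases t with
    | node f ts =>
      simp only [toWord, List.length_cons, List.length_flatten, sizeBound, List.map_ofFn,
        List.sum_ofFn, Function.comp_apply]
      have h1 : ∑ i, (toWord (ts i)).length ≤ ∑ _i : Fin (ar f), sizeBound r n :=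
        Finset.sum_le_sum fun i _ => ih (h i)
      have h2 := Nat.mul_le_mul_right (sizeBound r n) (hr f)
      simp only [Finset.sum_const, Finset.card_univ, Fintype.card_fin, smul_eq_mul] at h1
      omega

theorem toWord_injective : Function.Injective (toWord (ar := ar)) := fun _ _ h =>
  (wordEquiv ar).injective (Subtype.ext h)

/-- The list of subterms. -/
def subterms : Term ar → List (Term ar)
  | node f ts => node f ts :: (List.ofFn fun i => subterms (ts i)).flatten

theorem self_mem_subterms (t : Term ar) : t ∈ subterms t := by
  cases t; simp [subterms]

theorem length_subterms (t : Term ar) : (subterms t).length = (toWord t).length := by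
  induction t with
  | node f ts ih =>
    simp [subterms, toWord, List.length_flatten, List.map_ofFn, List.sum_ofFn, ih]

theorem child_mem_subterms {f : σ} {ts : Fin (ar f) → Term ar} {t : Term ar}
    (h : node f ts ∈ subterms t) (i : Fin (ar f)) : ts i ∈ subterms t := by
  induction t with
  | node g us ih =>
    simp only [subterms, List.mem_cons, List.mem_flatten, List.mem_ofFn] at h ⊢
    rcases h with h | ⟨_, ⟨j, rfl⟩, h⟩
    · cases h
      exact Or.inr ⟨_, ⟨i, rfl⟩, self_mem_subterms _⟩
    · exact Or.inr ⟨_, ⟨j, rfl⟩, ih j h⟩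

end Term

/-! ### Derivations of bounded depth -/

namespace TreeGrammar

variable {σ : Type u} {ar : σ → ℕ} {ν : Type v} {β : Type w}

/-- `G.Derives d α e`: the term `e` has a parse tree of depth at most `d` from the sentential
form `α`. -/
inductive Derives (G : TreeGrammar ar ν) : ℕ → Term (withNullary ar ν) → Term ar → Prop
  | sym (d : ℕ) (f : σ) (αs : Fin (ar f) → Term (withNullary ar ν)) (es : Fin (ar f) → Term ar)
      (h : ∀ i, Derives G d (αs i) (es i)) : Derives G d (.node (.inl f) αs) (.node f es)
  | expand (d : ℕ) (X : ν) (ts : Fin 0 → Term (withNullary ar ν)) (α : Term (withNullary ar ν))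
      (e : Term ar) (h : (X, α) ∈ G.prods) (h' : Derives G d α e) :
      Derives G (d + 1) (.node (.inr X) ts) e

variable {G : TreeGrammar ar ν}

theorem Derives.mono {d d' : ℕ} {α : Term (withNullary ar ν)} {e : Term ar}
    (h : G.Derives d α e) (hd : d ≤ d') : G.Derives d' α e := by
  induction h generalizing d' with
  | sym d f αs es _ ih => exact .sym _ _ _ _ fun i => ih i hd
  | expand d X ts α e hp _ ih =>
    obtain ⟨d', rfl⟩ : ∃ n, d' = n + 1 := ⟨d' - 1, by omega⟩
    exact .expand _ _ _ _ _ hp (ih (by omega))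

theorem ParseTree.derives {α : Term (withNullary ar ν)} {e : Term ar} (p : G.ParseTree α e) :
    G.Derives p.depth α e := by
  induction p with
  | sym f αs es ps ih =>
    exact .sym _ _ _ _ fun i => (ih i).mono
      (Finset.le_sup (f := fun i => (ps i).depth) (Finset.mem_univ i))
  | expand X ts α e h p ih => exact .expand _ _ _ _ _ h ih

theorem Derives.exists_parseTree {d : ℕ} {α : Term (withNullary ar ν)} {e : Term ar}
    (h : G.Derives d α e) : ∃ p : G.ParseTree α e, p.depth ≤ d := by
  induction h with
  | sym d f αs es _ ih =>
    choose ps hps using ih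
    exact ⟨.sym f αs es ps, Finset.sup_le fun i _ => hps i⟩
  | expand d X ts α e hp _ ih =>
    obtain ⟨p, h⟩ := ih
    exact ⟨.expand X ts α e hp p, Nat.succ_le_succ h⟩

theorem mem_language_iff {e : Term ar} :
    e ∈ G.language ↔ ∃ d, G.Derives d (nt ar G.start) e :=
  ⟨fun ⟨p⟩ => ⟨_, p.derives⟩, fun ⟨_, h⟩ => ⟨h.exists_parseTree.choose⟩⟩

/-- This trades the infimum in `ℕ∞` for bounded derivability. A term without parse trees has depth
`⊤`, so both sides fail for it. -/
theorem depth_le_iff {e : Term ar} {d : ℕ} :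
    G.depth e ≤ d ↔ G.Derives d (nt ar G.start) e := by
  constructor
  · intro h
    by_contra hn
    have : ((d + 1 : ℕ) : ℕ∞) ≤ G.depth e := le_iInf fun p => by
      have : ¬ p.depth ≤ d := fun hp => hn (p.derives.mono hp)
      exact_mod_cast (by omega : d + 1 ≤ p.depth)
    have := this.trans h
    norm_cast at this
    omega
  · intro h
    obtain ⟨p, hp⟩ := h.exists_parseTree
    exact (iInf_le _ p).trans (by exact_mod_cast hp)

theorem derives_inl_iff {d : ℕ} {f : σ} {αs : Fin (ar f) → Term (withNullary ar ν)}
    {e : Term ar} : G.Derives d (.node (.inl f) αs) e ↔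
      ∃ es : Fin (ar f) → Term ar, e = .node f es ∧ ∀ i, G.Derives d (αs i) (es i) := by
  constructor
  · intro h
    cases h with
    | sym _ _ _ es h => exact ⟨es, rfl, h⟩
  · rintro ⟨es, rfl, h⟩
    exact .sym _ _ _ _ h

theorem derives_inr_succ_iff {d : ℕ} {X : ν} {ts : Fin 0 → Term (withNullary ar ν)}
    {e : Term ar} : G.Derives (d + 1) (.node (.inr X) ts) e ↔
      ∃ α, (X, α) ∈ G.prods ∧ G.Derives d α e := by
  constructor
  · intro h
    cases h with
    | expand _ _ _ α _ hp h => exact ⟨α, hp, h⟩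
  · rintro ⟨α, hp, h⟩
    exact .expand _ _ _ _ _ hp h

theorem not_derives_zero_nt {X : ν} {e : Term ar} : ¬ G.Derives 0 (nt ar X) e := by
  intro h
  generalize hd : 0 = d at h
  unfold nt at h
  cases h
  omega

theorem node_inr_eq_nt (X : ν) (ts : Fin 0 → Term (withNullary ar ν)) :
    (.node (.inr X) ts : Term (withNullary ar ν)) = nt ar X :=
  congrArg (Term.node (ar := withNullary ar ν) (Sum.inr X))
    (Subsingleton.elim (α := Fin 0 → Term (withNullary ar ν)) _ _)

/-- Induction on sentential forms. -/
@[elab_as_elim]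
theorem form_induction {p : Term (withNullary ar ν) → Prop}
    (sym : ∀ (f : σ) (αs : Fin (ar f) → Term (withNullary ar ν)), (∀ i, p (αs i)) →
      p (.node (.inl f) αs)) (nonterminal : ∀ X, p (nt ar X)) (α : Term (withNullary ar ν)) :
    p α := by
  induction α with
  | node s αs ih =>
    cases s with
    | inl f => exact sym f αs ih
    | inr X =>
      have h := nonterminal X
      rwa [← node_inr_eq_nt X αs] at h

/-- The values under `v` of the terms obtained from a sentential form by replacing every nonterminal
`X` by terms with values in `V X`. -/
def formValues (v : Term ar → β) (V : ν → Set β) : Term (withNullary ar ν) → Set β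
  | .node (.inl f) αs => {b | ∃ es : Fin (ar f) → Term ar,
      v (.node f es) = b ∧ ∀ i : Fin (ar f), v (es i) ∈ formValues v V (αs i)}
  | .node (.inr X) _ => V X

/-- The children of a node are derived independently of each other, so representatives of their
classes can be chosen separately; the congruence makes the choice irrelevant for the class of the
node. -/
theorem formValues_derives {v : Term ar → β} (hv : IsCongr v) (d : ℕ)
    (α : Term (withNullary ar ν)) :
    formValues v (fun X => {b | ∃ e, G.Derives d (nt ar X) e ∧ v e = b}) α =
      {b | ∃ e, G.Derives d α e ∧ v e = b} := by
  induction α using form_induction with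
  | sym f αs ih =>
    ext b
    simp only [formValues, Set.mem_ofPred_eq, derives_inl_iff, ih]
    constructor
    · rintro ⟨es, rfl, h⟩
      choose es' h1 h2 using h
      exact ⟨_, ⟨es', rfl, h1⟩, hv _ _ _ h2⟩
    · rintro ⟨_, ⟨es, rfl, h⟩, rfl⟩
      exact ⟨es, rfl, fun i => ⟨es i, h i, rfl⟩⟩
  | nonterminal X => rfl

/-- One unit of depth is one application of the operator given by the productions. Everything about
depth is later read off from this recursion. -/
theorem values_succ {v : Term ar → β} (hv : IsCongr v) (d : ℕ) (X : ν) :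
    {b | ∃ e, G.Derives (d + 1) (nt ar X) e ∧ v e = b} =
      {b | ∃ α, (X, α) ∈ G.prods ∧
        b ∈ formValues v (fun X => {b | ∃ e, G.Derives d (nt ar X) e ∧ v e = b}) α} := by
  ext b
  simp only [formValues_derives hv]
  simp only [Set.mem_ofPred_eq, nt, derives_inr_succ_iff]
  constructor
  · rintro ⟨e, ⟨α, h1, h2⟩, h3⟩
    exact ⟨α, h1, e, h2, h3⟩
  · rintro ⟨α, h1, e, h2, h3⟩
    exact ⟨e, ⟨α, h1, h2⟩, h3⟩

/-- Every derivable value of a congruence of finite index is the value of a term of small depth. -/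
theorem exists_derives_of_isCongr [Fintype β] {v : Term ar → β} (hv : IsCongr v)
    {d : ℕ} {X : ν} {e : Term ar} (h : G.Derives d (nt ar X) e) :
    ∃ e', v e' = v e ∧ G.Derives (G.prods.length * Fintype.card β) (nt ar X) e' := by
  classical
  -- Only left-hand sides of productions derive anything. This gives a finite set even for infinite
  -- `ν`, as is needed for nonterminals in `ℕ`.
  let S : Finset (ν × β) := (G.prods.map Prod.fst).toFinset ×ˢ Finset.univ
  have hS : (S : Set (ν × β)).ncard ≤ G.prods.length * Fintype.card β := by
    rw [Set.ncard_coe_finset, Finset.card_product]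
    refine Nat.mul_le_mul ((List.toFinset_card_le _).trans (by simp)) (by simp)
  let R : ℕ → Set (ν × β) := fun n => {p | ∃ e, G.Derives n (nt ar p.1) e ∧ v e = p.2}
  have hR : ∀ n, R (n + 1) = {p | ∃ α, (p.1, α) ∈ G.prods ∧
      p.2 ∈ formValues v (fun X => {b | (X, b) ∈ R n}) α} := by
    intro n
    ext ⟨X, b⟩
    exact Set.ext_iff.1 (values_succ hv n X) b
  have := chain_subset_of_ncard_le (R := R) S.finite_toSet hS (fun n => by
      rintro ⟨X, b⟩ h
      cases n with
      | zero => exact (not_derives_zero_nt h.choose_spec.1).elim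
      | succ n =>
        rw [hR] at h
        obtain ⟨α, h, -⟩ := h
        simp only [S, Finset.coe_product, Set.mem_prod, Finset.mem_coe, List.mem_toFinset,
          List.mem_map, Finset.mem_univ, and_true]
        exact ⟨_, h, rfl⟩)
    (fun n p ⟨e, h1, h2⟩ => ⟨e, h1.mono n.le_succ, h2⟩)
    (fun n h => by rw [hR, hR, h]) d
  obtain ⟨e', h1, h2⟩ := @this (X, v e) ⟨e, h, rfl⟩
  exact ⟨e', h2, h1⟩

/-- A term that is derivable at all is derivable with depth bounded in terms of its size. -/
theorem Derives.length_mul {d : ℕ} {X : ν} {e : Term ar} (h : G.Derives d (nt ar X) e) :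
    G.Derives (G.prods.length * (e.toWord.length + 1)) (nt ar X) e := by
  classical
  -- Every subterm of `e` is a class of its own, and all other terms form the class `none`. This is
  -- a congruence because subterms are closed under children. The class of `e` is a singleton, so
  -- the representative of small depth is `e` itself; the extra `1` in the bound is for `none`.
  let v : Term ar → Option {u // u ∈ e.subterms.toFinset} := fun u =>
    if h : u ∈ e.subterms then some ⟨u, List.mem_toFinset.2 h⟩ else none
  have hval : ∀ {u u'}, v u = v u' → (u ∈ e.subterms ↔ u' ∈ e.subterms) ∧
      (u ∈ e.subterms → u = u') := by
    intro u u' h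
    by_cases h1 : u ∈ e.subterms <;> by_cases h2 : u' ∈ e.subterms <;> simp_all [v]
  have hv : IsCongr v := by
    have key : ∀ (f : σ) (ts ts' : Fin (ar f) → Term ar), (∀ i, v (ts i) = v (ts' i)) →
        .node f ts ∈ e.subterms → .node f ts = Term.node f ts' := fun f ts ts' h h1 =>
      congrArg _ (funext fun i => (hval (h i)).2 (Term.child_mem_subterms h1 i))
    intro f ts ts' h
    by_cases h1 : .node f ts ∈ e.subterms
    · rw [key f ts ts' h h1]
    · by_cases h2 : .node f ts' ∈ e.subterms
      · rw [key f ts' ts (fun i => (h i).symm) h2]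
      · simp [v, h1, h2]
  obtain ⟨e', h1, h2⟩ := exists_derives_of_isCongr hv h
  have h3 : e = e' := (hval h1.symm).2 e.self_mem_subterms
  rw [← h3] at h2
  refine h2.mono (Nat.mul_le_mul_left _ ?_)
  rw [Fintype.card_option, Fintype.card_coe, ← Term.length_subterms]
  exact Nat.succ_le_succ (List.toFinset_card_le _)

/-- The productions with right-hand sides in Polish notation. -/
def wordProds (G : TreeGrammar ar ν) : List (ν × List (σ ⊕ ν)) :=
  G.prods.map fun p => (p.1, p.2.toWord)

/-- The list of the subterms of all right-hand sides. -/
def rhsSubterms (G : TreeGrammar ar ν) : List (Term (withNullary ar ν)) :=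
  G.prods.flatMap fun p => p.2.subterms

/-- The total size of the right-hand sides of productions in Polish notation. -/
def rhsSize (P : List (ν × List (σ ⊕ ν))) : ℕ :=
  (P.flatMap Prod.snd).length

theorem length_rhsSubterms : G.rhsSubterms.length = rhsSize G.wordProds := by
  simp [rhsSubterms, rhsSize, wordProds, List.length_flatMap, List.flatMap_map,
    Term.length_subterms]

/-- A derivation that starts in `rhsSubterms` stays there: expanding leads to a whole right-hand
side, and reading `f` leads to children of a form already in the list. So only the forms in this
list that derive the children matter. -/
theorem Derives.congr_node {f : σ} {es es' : Fin (ar f) → Term ar}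
    (hes : ∀ i, ∀ α ∈ G.rhsSubterms, (∃ d, G.Derives d α (es i)) → ∃ d, G.Derives d α (es' i))
    {d : ℕ} {α : Term (withNullary ar ν)} (hα : α ∈ G.rhsSubterms)
    (h : G.Derives d α (.node f es)) : ∃ d, G.Derives d α (.node f es') := by
  generalize he : Term.node f es = e at h
  induction h with
  | sym d g αs us h ih =>
    cases he
    have h1 : ∀ i, αs i ∈ G.rhsSubterms := fun i => by
      obtain ⟨p, hp, h⟩ := List.mem_flatMap.1 hα
      exact List.mem_flatMap.2 ⟨p, hp, Term.child_mem_subterms h i⟩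
    choose n hn using fun i => hes i (αs i) (h1 i) ⟨d, h i⟩
    exact ⟨Finset.univ.sup n, .sym _ _ _ _ fun i =>
      (hn i).mono (Finset.le_sup (Finset.mem_univ i))⟩
  | expand d X ts β e hp _ ih =>
    obtain ⟨n, hn⟩ := ih (List.mem_flatMap.2 ⟨_, hp, Term.self_mem_subterms _⟩) he
    exact ⟨n + 1, .expand _ _ _ _ _ hp hn⟩

/-- The languages derived from the nonterminals of a grammar are saturated by a congruence of finite
index. -/
theorem exists_isCongr (G : TreeGrammar ar ν) :
    ∃ v : Term ar → Fin (2 ^ rhsSize G.wordProds), IsCongr v ∧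
      ∀ X, Saturates v {e | ∃ d, G.Derives d (nt ar X) e} := by
  classical
  -- The class of `e` records which subterms of right-hand sides derive it. This also decides
  -- derivability from a nonterminal, since such a derivation continues from a right-hand side.
  let v : Term ar → Set (Fin G.rhsSubterms.length) := fun e => {i | ∃ d, G.Derives d G.rhsSubterms[i] e}
  have hval : ∀ {e e'}, v e = v e' → ∀ α ∈ G.rhsSubterms,
      (∃ d, G.Derives d α e) → ∃ d, G.Derives d α e' := by
    intro e e' h α hα hd
    obtain ⟨i, hi, rfl⟩ := List.getElem_of_mem hα
    exact (Set.ext_iff.1 h ⟨i, hi⟩).1 hd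
  have hv : IsCongr v := by
    intro f ts ts' h
    ext i
    exact ⟨fun ⟨_, hd⟩ => hd.congr_node (fun j => hval (h j)) (List.getElem_mem _),
      fun ⟨_, hd⟩ => hd.congr_node (fun j => hval (h j).symm) (List.getElem_mem _)⟩
  have hs : ∀ X e e', v e = v e' → (∃ d, G.Derives d (nt ar X) e) →
      ∃ d, G.Derives d (nt ar X) e' := by
    rintro X e e' h ⟨d, hd⟩
    cases d with
    | zero => exact (not_derives_zero_nt hd).elim
    | succ d =>
      obtain ⟨α, hp, hd⟩ := derives_inr_succ_iff.1 hd
      obtain ⟨n, hn⟩ := hval h α (List.mem_flatMap.2 ⟨_, hp, Term.self_mem_subterms _⟩) ⟨d, hd⟩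
      exact ⟨n + 1, .expand _ _ _ _ _ hp hn⟩
  have hcard : Fintype.card (Set (Fin G.rhsSubterms.length)) = 2 ^ rhsSize G.wordProds := by
    rw [Fintype.card_set, Fintype.card_fin, length_rhsSubterms]
  let φ := Fintype.equivFinOfCardEq hcard
  refine ⟨fun t => φ (v t), hv.comp_injective φ.injective, fun X => ?_⟩
  exact Saturates.comp_injective (v := v)
    (fun t t' h => ⟨hs X t t' h, hs X t' t h.symm⟩) φ.injective

end TreeGrammar

/-! ### Derivations on words -/

section Words

variable {σ : Type u} {ν : Type v} [DecidableEq ν]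

/-- The words obtained from a word by replacing every nonterminal by an associated word. -/
def substWord (E : List (ν × List σ)) (u : List (σ ⊕ ν)) : List (List σ) :=
  u.foldr (fun s L => s.elim (fun f => L.map (f :: ·))
    fun X => E.flatMap fun p => if p.1 = X then L.map (p.2 ++ ·) else []) [[]]

theorem mem_substWord_inl {E : List (ν × List σ)} {f : σ} {u : List (σ ⊕ ν)} {w : List σ} :
    w ∈ substWord E (.inl f :: u) ↔ ∃ w' ∈ substWord E u, f :: w' = w := by
  simp [substWord]

theorem mem_substWord_inr {E : List (ν × List σ)} {X : ν} {u : List (σ ⊕ ν)} {w : List σ} :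
    w ∈ substWord E (.inr X :: u) ↔ ∃ w₁, (X, w₁) ∈ E ∧ ∃ w₂ ∈ substWord E u, w₁ ++ w₂ = w := by
  have : substWord E (.inr X :: u) =
    E.flatMap fun p => if p.1 = X then (substWord E u).map (p.2 ++ ·) else [] := rfl
  rw [this, List.mem_flatMap]
  constructor
  · rintro ⟨⟨Y, w₁⟩, h1, h2⟩
    split_ifs at h2 with h
    · obtain rfl : Y = X := h
      obtain ⟨w₂, h3, h4⟩ := List.mem_map.1 h2
      exact ⟨w₁, h1, w₂, h3, h4⟩
    · simp at h2
  · rintro ⟨w₁, h1, w₂, h3, h4⟩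
    refine ⟨(X, w₁), h1, ?_⟩
    rw [if_pos rfl]
    exact List.mem_map.2 ⟨w₂, h3, h4⟩

theorem mem_substWord_append {E : List (ν × List σ)} {u u' : List (σ ⊕ ν)} {w : List σ} :
    w ∈ substWord E (u ++ u') ↔ ∃ w₁ ∈ substWord E u, ∃ w₂ ∈ substWord E u', w₁ ++ w₂ = w := by
  induction u generalizing w with
  | nil => simp [substWord]
  | cons s u ih =>
    cases s with
    | inl f =>
      rw [List.cons_append]
      simp only [mem_substWord_inl, ih]
      constructor
      · rintro ⟨_, ⟨w₁, h1, w₂, h2, rfl⟩, rfl⟩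
        exact ⟨_, ⟨w₁, h1, rfl⟩, w₂, h2, rfl⟩
      · rintro ⟨_, ⟨w₁, h1, rfl⟩, w₂, h2, rfl⟩
        exact ⟨_, ⟨w₁, h1, w₂, h2, rfl⟩, rfl⟩
    | inr X =>
      rw [List.cons_append]
      simp only [mem_substWord_inr, ih]
      constructor
      · rintro ⟨w₀, h0, _, ⟨w₁, h1, w₂, h2, rfl⟩, rfl⟩
        exact ⟨_, ⟨w₀, h0, w₁, h1, rfl⟩, w₂, h2, List.append_assoc _ _ _⟩
      · rintro ⟨_, ⟨w₀, h0, w₁, h1, rfl⟩, w₂, h2, rfl⟩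
        exact ⟨w₀, h0, _, ⟨w₁, h1, w₂, h2, rfl⟩, (List.append_assoc _ _ _).symm⟩

theorem mem_substWord_flatten_ofFn {E : List (ν × List σ)} {n : ℕ} {us : Fin n → List (σ ⊕ ν)}
    {w : List σ} : w ∈ substWord E (List.ofFn us).flatten ↔
      ∃ ws : Fin n → List σ, (∀ i, ws i ∈ substWord E (us i)) ∧ (List.ofFn ws).flatten = w := by
  induction n generalizing w with
  | zero => simp [substWord, eq_comm]
  | succ n ih =>
    rw [List.ofFn_succ, List.flatten_cons, mem_substWord_append]
    simp only [ih]
    constructor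
    · rintro ⟨w₁, h1, _, ⟨ws, h2, rfl⟩, rfl⟩
      exact ⟨Fin.cons w₁ ws, fun i => Fin.cases h1 h2 i, by simp [List.ofFn_succ]⟩
    · rintro ⟨ws, h, rfl⟩
      exact ⟨ws 0, h 0, _, ⟨fun i => ws i.succ, fun i => h i.succ, rfl⟩, by simp [List.ofFn_succ]⟩

/-- The list of pairs of a nonterminal and a word that can be derived from it with depth at
most `d`. -/
def derivableWords (P : List (ν × List (σ ⊕ ν))) : ℕ → List (ν × List σ)
  | 0 => []
  | d + 1 => P.flatMap fun p => (substWord (derivableWords P d) p.2).map (Prod.mk p.1)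

/-- Substitution in Polish notation is concatenation, so the derivable terms of bounded depth can be
listed without parsing any word. -/
theorem mem_derivableWords_iff {ar : σ → ℕ} {G : TreeGrammar ar ν} {d : ℕ} {X : ν} {w : List σ} :
    (X, w) ∈ derivableWords G.wordProds d ↔
      ∃ e : Term ar, e.toWord = w ∧ G.Derives d (TreeGrammar.nt ar X) e := by
  induction d generalizing X w with
  | zero =>
    simp only [derivableWords, List.not_mem_nil, false_iff]
    rintro ⟨e, -, h⟩
    exact TreeGrammar.not_derives_zero_nt h
  | succ d ih =>
    have key : ∀ (α : Term (withNullary ar ν)) (w : List σ),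
        w ∈ substWord (derivableWords G.wordProds d) α.toWord ↔
          ∃ e : Term ar, e.toWord = w ∧ G.Derives d α e := by
      intro α
      induction α using TreeGrammar.form_induction with
      | sym f αs ihα =>
        intro w
        have h0 : (Term.node (ar := withNullary ar ν) (.inl f) αs).toWord =
          .inl f :: (List.ofFn fun i : Fin (ar f) => (αs i).toWord).flatten := rfl
        simp only [h0, mem_substWord_inl, mem_substWord_flatten_ofFn,
          TreeGrammar.derives_inl_iff, ihα]
        constructor
        · rintro ⟨_, ⟨ws, h, rfl⟩, rfl⟩
          choose es h1 h2 using h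
          refine ⟨_, ?_, es, rfl, h2⟩
          simp [Term.toWord, h1]
        · rintro ⟨_, rfl, es, rfl, h⟩
          exact ⟨_, ⟨fun i => (es i).toWord, fun i => ⟨es i, rfl, h i⟩, rfl⟩, rfl⟩
      | nonterminal Y =>
        intro w
        have h0 : (TreeGrammar.nt ar Y).toWord = [.inr Y] := rfl
        rw [h0, mem_substWord_inr]
        simp [substWord, ih]
    simp only [derivableWords, List.mem_flatMap, List.mem_map, Prod.mk.injEq,
      TreeGrammar.wordProds, TreeGrammar.nt, TreeGrammar.derives_inr_succ_iff]
    constructor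
    · rintro ⟨_, ⟨⟨Y, α⟩, hp, rfl⟩, w', hw, rfl, rfl⟩
      obtain ⟨e, h1, h2⟩ := (key α w').1 hw
      exact ⟨e, h1, α, hp, h2⟩
    · rintro ⟨e, rfl, α, hp, h⟩
      exact ⟨_, ⟨(X, α), hp, rfl⟩, e.toWord, (key α _).2 ⟨e, rfl, h⟩, rfl, rfl⟩

/-- The word is derivable from the nonterminal. -/
def WordDerivable (P : List (ν × List (σ ⊕ ν))) (X : ν) (w : List σ) : Prop :=
  (X, w) ∈ derivableWords P (P.length * (w.length + 1))

/-- The depth built into `WordDerivable` is the bound of `Derives.length_mul`, hence the test loses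
nothing. -/
theorem wordDerivable_iff {ar : σ → ℕ} {G : TreeGrammar ar ν} {X : ν} {e : Term ar} :
    WordDerivable G.wordProds X e.toWord ↔ ∃ d, G.Derives d (TreeGrammar.nt ar X) e := by
  rw [WordDerivable, mem_derivableWords_iff]
  constructor
  · rintro ⟨e', h1, h2⟩
    obtain rfl := Term.toWord_injective h1
    exact ⟨_, h2⟩
  · rintro ⟨d, h⟩
    refine ⟨e, rfl, ?_⟩
    have := h.length_mul
    rwa [← (List.length_map (as := G.prods) fun p => (p.1, p.2.toWord))] at this

end Words

/-! ### Tree automata as grammars -/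

namespace TreeAutomaton

variable {σ : Type u} {ar : σ → ℕ}

/-- The productions in Polish notation of a grammar that simulates the automaton. -/
def wordProds (ar : σ → ℕ) (A : TreeAutomaton σ) : List (ℕ × List (σ ⊕ ℕ)) :=
  A.trans.filterMap fun p =>
    if p.2.2.length = ar p.2.1 then some (p.1, .inl p.2.1 :: p.2.2.map .inr) else none

/-- States become nonterminals and transitions become productions, so the congruence and the
membership test for grammars serve automata too. Transitions whose list of states has the wrong
length can never be used and are dropped. -/
theorem exists_grammar (ar : σ → ℕ) (A : TreeAutomaton σ) :
    ∃ G : TreeGrammar ar ℕ, G.wordProds = A.wordProds ar ∧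
      ∀ e q, A.AcceptsFrom e q ↔ ∃ d, G.Derives d (TreeGrammar.nt ar q) e := by
  let G : TreeGrammar ar ℕ := ⟨0, A.trans.filterMap fun p : ℕ × σ × List ℕ =>
    if h : p.2.2.length = ar p.2.1 then some (p.1, Term.node (ar := withNullary ar ℕ)
      (Sum.inl p.2.1) fun i : Fin (ar p.2.1) => TreeGrammar.nt ar (p.2.2.get (i.cast h.symm)))
    else none⟩
  have hp : ∀ q α, (q, α) ∈ G.prods ↔ ∃ (f : σ) (qs : Fin (ar f) → ℕ),
      (q, f, List.ofFn qs) ∈ A.trans ∧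
        α = .node (.inl f) fun i : Fin (ar f) => TreeGrammar.nt ar (qs i) := by
    intro q α
    simp only [G, List.mem_filterMap]
    constructor
    · rintro ⟨⟨q', f, l⟩, h1, h2⟩
      split_ifs at h2 with h
      simp only [Option.some.injEq, Prod.mk.injEq] at h2
      obtain ⟨rfl, rfl⟩ := h2
      simp only at h
      refine ⟨f, fun i => l.get (i.cast h.symm), ?_, rfl⟩
      convert h1 using 3
      apply List.ext_getElem <;> simp [h]
    · rintro ⟨f, qs, h, rfl⟩
      exact ⟨_, h, by simp⟩
  refine ⟨G, ?_, ?_⟩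
  · simp only [TreeGrammar.wordProds, wordProds, G, List.map_filterMap]
    congr 1
    funext ⟨q, f, l⟩
    split_ifs with h
    · simp only at h
      simp only [Option.map_some, Term.toWord, Option.some.injEq, Prod.mk.injEq, true_and,
        List.cons.injEq]
      have : ∀ X : ℕ, (TreeGrammar.nt ar X).toWord = [.inr X] := fun X => rfl
      simp only [this]
      have h2 : (List.ofFn fun i : Fin (ar f) => [(Sum.inr (l.get (i.cast h.symm)) : σ ⊕ ℕ)]) =
          l.map fun x => [Sum.inr x] := by
        apply List.ext_getElem <;> simp [h]
      refine (congrArg List.flatten h2).trans ?_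
      clear h2 h
      induction l <;> simp_all
    · rfl
  · intro e
    induction e with
    | node f ts ih =>
      intro q
      constructor
      · rintro ⟨qs, h, hqs⟩
        choose n hn using fun i => (ih i (qs i)).1 (hqs i)
        exact ⟨_ + 1, .expand _ _ _ _ _ ((hp _ _).2 ⟨f, qs, h, rfl⟩)
          (.sym (Finset.univ.sup n) _ _ _ fun i =>
            (hn i).mono (Finset.le_sup (Finset.mem_univ i)))⟩
      · rintro ⟨d, hd⟩
        cases d with
        | zero => exact (TreeGrammar.not_derives_zero_nt hd).elim
        | succ d =>
          obtain ⟨α, h1, h2⟩ := TreeGrammar.derives_inr_succ_iff.1 hd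
          obtain ⟨g, qs, h3, rfl⟩ := (hp _ _).1 h1
          obtain ⟨es, h4, h5⟩ := TreeGrammar.derives_inl_iff.1 h2
          cases h4
          exact ⟨qs, h3, fun i => (ih i _).2 ⟨d, h5 i⟩⟩

/-- The language of an automaton is saturated by a congruence of finite index. -/
theorem exists_isCongr (ar : σ → ℕ) (A : TreeAutomaton σ) :
    ∃ v : Term ar → Fin (2 ^ TreeGrammar.rhsSize (A.wordProds ar)), IsCongr v ∧
      Saturates v (A.language ar) := by
  obtain ⟨G, hG, hA⟩ := A.exists_grammar ar
  have := G.exists_isCongr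
  rw [hG] at this
  obtain ⟨v, hv, hs⟩ := this
  refine ⟨v, hv, fun t t' h => ?_⟩
  have key : ∀ q, A.AcceptsFrom t q ↔ A.AcceptsFrom t' q := fun q => by
    rw [hA, hA]
    exact hs q t t' h
  simp only [language, Set.mem_ofPred_eq, key]

theorem mem_language_iff {A : TreeAutomaton σ} {e : Term ar} : e ∈ A.language ar ↔
    ∃ q ∈ A.init, WordDerivable (A.wordProds ar) q e.toWord := by
  obtain ⟨G, hG, hA⟩ := A.exists_grammar ar
  simp only [← hG, wordDerivable_iff, ← hA]
  rfl

end TreeAutomaton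

/-! ### Synthesis from tree automata -/

section Tasks

variable {σ : Type u} {ar : σ → ℕ} {N : Type v}

/-- The term belongs to the language of the grammar and of all automata in the list. -/
def AcceptedByAll (B : TreeGrammar ar N) (As : List (TreeAutomaton σ)) (e : Term ar) : Prop :=
  e ∈ B.language ∧ ∀ A ∈ As, e ∈ A.language ar

/-- With bounded depth, `H` generalizes on the instance with the given automata for the training and
the testing examples. -/
def GeneralizesAt (B H : TreeGrammar ar N) (T : List (TreeAutomaton σ) × List (TreeAutomaton σ))
    (d : ℕ) : Prop :=
  (∃ e, H.Derives (d + 1) (TreeGrammar.nt ar H.start) e ∧ AcceptedByAll B (T.1 ++ T.2) e) ∧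
    ∀ e, H.Derives d (TreeGrammar.nt ar H.start) e → AcceptedByAll B T.1 e → AcceptedByAll B T.2 e

/-- Solutions of DSL synthesis when the examples are given by tree automata. -/
def IsAutomataSolution (B : TreeGrammar ar N)
    (inp : List (List (TreeAutomaton σ) × List (TreeAutomaton σ)) ×
      TreeGrammar (GSym.arity ar N) ℕ) (G : TreeGrammar ar N) : Prop :=
  G.StartsOnTop ∧ (∀ T ∈ inp.1, ∃ d, GeneralizesAt B (G.extend B) T d) ∧ G.enc ∈ inp.2.language

/-- Comparing depths with every non-generalizing expression amounts to a threshold: no such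
expression has depth below the least depth `d + 1` of a solving one. Adequacy is implied by the
generalization clause. -/
theorem isSolution_iff {M : Type w} {B : BaseLanguage ar N M} {A : M → TreeAutomaton σ}
    (hA : ∀ m, (A m).language ar = {e | e ∈ B.grammar.language ∧ B.consistent e m})
    (inp : SynthesisInput ar N M) (G : TreeGrammar ar N) :
    IsSolution B inp G ↔ IsAutomataSolution B.grammar
      (inp.1.map fun I => (I.train.map A, I.test.map A), inp.2) G := by
  have hacc : ∀ (X : List M) (e : Term ar),
      AcceptedByAll B.grammar (X.map A) e ↔ B.SolvesSet e X := by
    intro X e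
    simp only [AcceptedByAll, BaseLanguage.SolvesSet, List.forall_mem_map, hA, Set.mem_ofPred_eq]
    exact ⟨fun h => ⟨h.1, fun m hm => (h.2 m hm).2⟩, fun h => ⟨h.1, fun m hm => ⟨h.1, h.2 m hm⟩⟩⟩
  have key : ∀ (H : TreeGrammar ar N) (I : LearningInstance M),
      (∃ e ∈ H.language, B.Solves e I ∧
        ∀ e' ∈ H.language, B.NonGeneralizing e' I → H.depthLE e e') ↔
      ∃ d, GeneralizesAt B.grammar H (I.train.map A, I.test.map A) d := by
    intro H I
    simp only [GeneralizesAt, ← List.map_append, hacc]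
    constructor
    · rintro ⟨e, he, hs, hmin⟩
      have hd := TreeGrammar.mem_language_iff.1 he
      classical
      have h1 := Nat.find_spec hd
      -- Deriving from a nonterminal costs at least one unit of depth, so the minimal depth has a
      -- predecessor, which is the threshold.
      have h2 : Nat.find hd ≠ 0 := fun h0 => by
        rw [h0] at h1
        exact TreeGrammar.not_derives_zero_nt h1
      obtain ⟨d, hd'⟩ := Nat.exists_eq_succ_of_ne_zero h2
      rw [hd'] at h1
      refine ⟨d, ⟨e, h1, hs⟩, fun e' he' ht => ?_⟩
      by_contra hn
      have h3 := hmin e' (TreeGrammar.mem_language_iff.2 ⟨d, he'⟩) ⟨ht, hn⟩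
      have h4 := TreeGrammar.depth_le_iff.1 (h3.trans (TreeGrammar.depth_le_iff.2 he'))
      have := Nat.find_min' hd h4
      omega
    · rintro ⟨d, ⟨e, he, hs⟩, hmin⟩
      refine ⟨e, TreeGrammar.mem_language_iff.2 ⟨_, he⟩, hs, fun e' _ hng => ?_⟩
      refine (TreeGrammar.depth_le_iff.2 he).trans ?_
      by_contra hlt
      rw [not_le] at hlt
      have : H.depth e' ≤ d := by
        rw [Nat.cast_add, Nat.cast_one] at hlt
        exact Order.le_of_lt_add_one hlt
      exact hng.2 (hmin e' (TreeGrammar.depth_le_iff.1 this) hng.1)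
  simp only [IsSolution, IsAutomataSolution, BaseLanguage.Generalizing, BaseLanguage.Adequate,
    List.forall_mem_map, ← key]
  refine and_congr_right fun _ => and_congr_left fun _ => ?_
  exact ⟨fun h => h.2, fun h => ⟨fun I hI => (h I hI).imp fun e he => ⟨he.1, he.2.1⟩, h⟩⟩

/-- The productions in Polish notation of all automata in the input. -/
def taskProds (ar : σ → ℕ) (Ts : List (List (TreeAutomaton σ) × List (TreeAutomaton σ))) :
    List (ℕ × List (σ ⊕ ℕ)) :=
  Ts.flatMap fun T => (T.1 ++ T.2).flatMap fun A => A.wordProds ar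

/-- An index of a congruence that saturates all languages occurring in the input. -/
def taskIndex (B : TreeGrammar ar N)
    (Ts : List (List (TreeAutomaton σ) × List (TreeAutomaton σ))) : ℕ :=
  2 ^ (TreeGrammar.rhsSize B.wordProds + TreeGrammar.rhsSize (taskProds ar Ts))

/-- Pairing congruences multiplies their indices, so the exponents of 2 add up; this keeps the index
an explicit function of the input. -/
theorem exists_isCongr_automata (B : TreeGrammar ar N) (As : List (TreeAutomaton σ)) :
    ∃ v : Term ar → Fin (2 ^ (TreeGrammar.rhsSize B.wordProds +
      TreeGrammar.rhsSize (As.flatMap fun A => A.wordProds ar))), IsCongr v ∧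
      Saturates v B.language ∧ ∀ A ∈ As, Saturates v (A.language ar) := by
  induction As with
  | nil =>
    obtain ⟨v, hv, hs⟩ := B.exists_isCongr
    refine ⟨v, hv, fun t t' h => ?_, by simp⟩
    rw [TreeGrammar.mem_language_iff, TreeGrammar.mem_language_iff]
    exact hs B.start t t' h
  | cons A As ih =>
    obtain ⟨v, hv, hB, hAs⟩ := ih
    obtain ⟨v', hv', hA⟩ := A.exists_isCongr ar
    let g := fun p : Fin (2 ^ (TreeGrammar.rhsSize B.wordProds +
        TreeGrammar.rhsSize (As.flatMap fun A => A.wordProds ar))) ×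
        Fin (2 ^ TreeGrammar.rhsSize (A.wordProds ar)) =>
      Fin.cast (m := 2 ^ (TreeGrammar.rhsSize B.wordProds +
        TreeGrammar.rhsSize ((A :: As).flatMap fun A => A.wordProds ar)))
        (by simp only [TreeGrammar.rhsSize, List.flatMap_cons, List.flatMap_append,
              List.length_append]; ring) (finProdFinEquiv p)
    have hg : g.Injective := (Fin.cast_injective _).comp finProdFinEquiv.injective
    have h1 : ∀ {L}, Saturates v L → Saturates (fun t => (v t, v' t)) L :=
      fun h t t' e => h t t' (Prod.ext_iff.1 e).1
    refine ⟨fun t => g (v t, v' t), (hv.prodMk hv').comp_injective hg,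
      (h1 hB).comp_injective hg, ?_⟩
    intro A' hA'
    rcases List.mem_cons.1 hA' with rfl | hA'
    · exact Saturates.comp_injective (fun t t' e => hA t t' (Prod.ext_iff.1 e).2) hg
    · exact (h1 (hAs A' hA')).comp_injective hg

theorem exists_isCongr_tasks (B : TreeGrammar ar N)
    (Ts : List (List (TreeAutomaton σ) × List (TreeAutomaton σ))) :
    ∃ v : Term ar → Fin (taskIndex B Ts), IsCongr v ∧ ∀ T ∈ Ts, ∀ As ⊆ T.1 ++ T.2,
      ∀ t t', v t = v t' → (AcceptedByAll B As t ↔ AcceptedByAll B As t') := by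
  have h := exists_isCongr_automata B (Ts.flatMap fun T => T.1 ++ T.2)
  rw [List.flatMap_assoc] at h
  obtain ⟨v, hv, hB, hA⟩ := h
  refine ⟨v, hv, fun T hT As hAs t t' e => and_congr (hB t t' e) ?_⟩
  exact forall₂_congr fun A hA' => hA A (List.mem_flatMap.2 ⟨T, hT, hAs hA'⟩) t t' e

/-- The depth in the definition of generalizing grammars can be bounded. -/
theorem exists_generalizesAt_iff {B H : TreeGrammar ar N}
    {Ts : List (List (TreeAutomaton σ) × List (TreeAutomaton σ))}
    {T : List (TreeAutomaton σ) × List (TreeAutomaton σ)} (hT : T ∈ Ts) :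
    (∃ d, GeneralizesAt B H T d) ↔
      ∃ d < H.prods.length * taskIndex B Ts, GeneralizesAt B H T d := by
  classical
  refine ⟨?_, fun ⟨d, _, h⟩ => ⟨d, h⟩⟩
  rintro ⟨d, ⟨e, he, hs⟩, hmin⟩
  obtain ⟨v, hv, hsat⟩ := exists_isCongr_tasks B Ts
  obtain ⟨e', h1, h2⟩ := TreeGrammar.exists_derives_of_isCongr hv he
  rw [Fintype.card_fin] at h2
  have hs' := (hsat T hT _ (List.Subset.refl _) _ _ h1).2 hs
  -- Take the least depth `n + 1` of a solving expression. It is at most the stationarity bound and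
  -- at most `d + 1`, and lowering `d` only weakens the condition on all expressions of depth at
  -- most `d`.
  have hex : ∃ n e, H.Derives n (TreeGrammar.nt ar H.start) e ∧
    AcceptedByAll B (T.1 ++ T.2) e := ⟨_, e', h2, hs'⟩
  have h3 := Nat.find_spec hex
  have h4 : Nat.find hex ≠ 0 := fun h0 => by
    rw [h0] at h3
    exact TreeGrammar.not_derives_zero_nt h3.choose_spec.1
  obtain ⟨n, hn⟩ := Nat.exists_eq_succ_of_ne_zero h4
  rw [hn] at h3
  have h5 := Nat.find_min' hex ⟨e', h2, hs'⟩
  have h6 := Nat.find_min' hex ⟨e, he, hs⟩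
  exact ⟨n, by omega, h3, fun e'' he'' => hmin e'' (he''.mono (by omega))⟩

end Tasks

/-! ### A congruence on grammar trees -/

section GrammarTrees

variable {σ : Type u} {ar : σ → ℕ} {N : Type v} {β : Type w}

/-- The interpretations of the right-hand side that is encoded by a grammar tree. -/
def formAttr (v : Term ar → β) (t : GTree ar N) : Set ((N → Set β) → Set β) :=
  {φ | ∃ α : Term (withNullary ar N), encTerm α = t ∧
    φ = fun V => TreeGrammar.formValues v V α}

/-- One step of the computation of derivable values. -/
def stepValues (v : Term ar → β) (l : List (N × Term (withNullary ar N))) (V : N → Set β) :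
    N → Set β :=
  fun X => {b | ∃ α, (X, α) ∈ l ∧ b ∈ TreeGrammar.formValues v V α}

/-- The first nonterminal and the interpretations of the list of productions that is encoded by a
grammar tree. -/
def prodsAttr (v : Term ar → β) (t : GTree ar N) :
    Set (Option N × ((N → Set β) → N → Set β)) :=
  {p | ∃ l, encProds l = t ∧ p = (l.head?.map Prod.fst, stepValues v l)}

/-- Decoding is compositional, so the attribute of a node is a function of those of its children.
Attributes are sets so that trees encoding nothing get the value `∅`. -/
theorem formAttr_base (v : Term ar → β) (f : σ) (ts : Fin (ar f) → GTree ar N) :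
    formAttr v (.node (.base f) ts) = {φ | ∃ φs : Fin (ar f) → (N → Set β) → Set β,
      (∀ i, φs i ∈ formAttr v (ts i)) ∧ φ = fun V => {b | ∃ es : Fin (ar f) → Term ar,
        v (.node f es) = b ∧ ∀ i, v (es i) ∈ φs i V}} := by
  ext φ
  constructor
  · rintro ⟨α, h, rfl⟩
    induction α using TreeGrammar.form_induction with
    | sym g αs _ =>
      simp only [encTerm] at h
      cases h
      exact ⟨fun i V => TreeGrammar.formValues v V (αs i), fun i => ⟨αs i, rfl, rfl⟩, rfl⟩
    | nonterminal X =>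
      simp only [encTerm, TreeGrammar.nt] at h
      cases h
  · rintro ⟨φs, h, rfl⟩
    choose αs h1 h2 using h
    refine ⟨.node (.inl f) αs, ?_, ?_⟩
    · simp only [encTerm, h1]
    · simp only [h2]
      rfl

/-- A further production enlarges the operator by a union at `X`. The first nonterminal of the tail
is forgotten, since `X` is now on top. -/
theorem prodsAttr_lhs (v : Term ar → β) (X : N) (ts : Fin 2 → GTree ar N) :
    prodsAttr v (.node (.lhs X) ts) = {p | ∃ φ ∈ formAttr v (ts 0), ∃ q ∈ prodsAttr v (ts 1),
      p = (some X, fun V Y => {b | (Y = X ∧ b ∈ φ V) ∨ b ∈ q.2 V Y})} := by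
  have hstep : ∀ (α : Term (withNullary ar N)) l, stepValues v ((X, α) :: l) = fun V Y =>
      {b | (Y = X ∧ b ∈ TreeGrammar.formValues v V α) ∨ b ∈ stepValues v l V Y} := by
    intro α l
    funext V Y
    ext b
    simp only [stepValues, List.mem_cons, Prod.mk.injEq, Set.mem_ofPred_eq]
    constructor
    · rintro ⟨γ, ⟨h1, rfl⟩ | h, hb⟩
      · exact Or.inl ⟨h1, hb⟩
      · exact Or.inr ⟨γ, h, hb⟩
    · rintro (⟨h1, hb⟩ | ⟨γ, h, hb⟩)
      · exact ⟨α, Or.inl ⟨h1, rfl⟩, hb⟩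
      · exact ⟨γ, Or.inr h, hb⟩
  ext p
  constructor
  · rintro ⟨_ | ⟨⟨Y, α⟩, l⟩, h, rfl⟩
    · simp only [encProds] at h
      cases h
    · simp only [encProds] at h
      cases h
      exact ⟨_, ⟨α, rfl, rfl⟩, _, ⟨l, rfl, rfl⟩, Prod.ext rfl (hstep α l)⟩
  · rintro ⟨_, ⟨α, h1, rfl⟩, _, ⟨l, h2, rfl⟩, rfl⟩
    refine ⟨(X, α) :: l, ?_, Prod.ext rfl (hstep α l).symm⟩
    simp only [encProds, h1, h2]
    congr 1
    funext i
    fin_cases i <;> rfl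

theorem formAttr_eq_empty (v : Term ar → β) {s : GSym σ N} {ts : Fin (GSym.arity ar N s) → GTree ar N}
    (h1 : ∀ f, s ≠ .base f) (h2 : ∀ X, s ≠ .rhs X) : formAttr v (.node s ts) = ∅ := by
  refine Set.eq_empty_of_forall_notMem ?_
  rintro _ ⟨α, h, rfl⟩
  induction α using TreeGrammar.form_induction with
  | sym g αs _ =>
    simp only [encTerm] at h
    cases h
    exact h1 _ rfl
  | nonterminal X =>
    simp only [encTerm, TreeGrammar.nt] at h
    cases h
    exact h2 _ rfl

theorem prodsAttr_eq_empty (v : Term ar → β) {s : GSym σ N}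
    {ts : Fin (GSym.arity ar N s) → GTree ar N}
    (h1 : s ≠ .fin) (h2 : ∀ X, s ≠ .lhs X) : prodsAttr v (.node s ts) = ∅ := by
  refine Set.eq_empty_of_forall_notMem ?_
  rintro _ ⟨_ | ⟨⟨Y, α⟩, l⟩, h, rfl⟩
  · simp only [encProds] at h
    cases h
    exact h1 rfl
  · simp only [encProds] at h
    cases h
    exact h2 _ rfl

theorem isCongr_attr (v : Term ar → β) :
    IsCongr fun t : GTree ar N => (formAttr v t, prodsAttr v t) := by
  intro s ts ts' h
  have h1 : ∀ i, formAttr v (ts i) = formAttr v (ts' i) := fun i => (Prod.ext_iff.1 (h i)).1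
  have h2 : ∀ i, prodsAttr v (ts i) = prodsAttr v (ts' i) := fun i => (Prod.ext_iff.1 (h i)).2
  cases s with
  | base f =>
    refine Prod.ext ?_ ?_
    · have h3 : ∀ i : Fin (ar f), formAttr v (ts i) = formAttr v (ts' i) := h1
      refine (formAttr_base v f ts).trans (Eq.trans ?_ (formAttr_base v f ts').symm)
      simp only [h3]
    · exact (prodsAttr_eq_empty v (by simp) (by simp)).trans
        (prodsAttr_eq_empty v (by simp) (by simp)).symm
  | root =>
    refine Prod.ext ?_ ?_
    · exact (formAttr_eq_empty v (by simp) (by simp)).trans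
        (formAttr_eq_empty v (by simp) (by simp)).symm
    · exact (prodsAttr_eq_empty v (by simp) (by simp)).trans
        (prodsAttr_eq_empty v (by simp) (by simp)).symm
  | fin =>
    obtain rfl : ts = ts' := Subsingleton.elim (α := Fin 0 → GTree ar N) _ _
    rfl
  | lhs X =>
    refine Prod.ext ?_ ?_
    · exact (formAttr_eq_empty v (by simp) (by simp)).trans
        (formAttr_eq_empty v (by simp) (by simp)).symm
    · refine (prodsAttr_lhs v X ts).trans (Eq.trans ?_ (prodsAttr_lhs v X ts').symm)
      have h3 := h1 (0 : Fin 2)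
      have h4 := h2 (1 : Fin 2)
      rw [h3, h4]
  | rhs X =>
    obtain rfl : ts = ts' := Subsingleton.elim (α := Fin 0 → GTree ar N) _ _
    rfl

/-- Both sides are iterates of the same operator, started from empty sets at depth 0. -/
theorem derives_values_congr {v : Term ar → β} (hv : IsCongr v) {G H : TreeGrammar ar N}
    (h : stepValues v G.prods = stepValues v H.prods) (d : ℕ) (X : N) :
    {b | ∃ e, G.Derives d (TreeGrammar.nt ar X) e ∧ v e = b} =
      {b | ∃ e, H.Derives d (TreeGrammar.nt ar X) e ∧ v e = b} := by
  induction d generalizing X with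
  | zero => simp [TreeGrammar.not_derives_zero_nt]
  | succ d ih =>
    rw [TreeGrammar.values_succ hv, TreeGrammar.values_succ hv]
    simp only [ih]
    exact congrFun (congrFun h _) X

theorem stepValues_append (v : Term ar → β) (l l' : List (N × Term (withNullary ar N))) :
    stepValues v (l ++ l') = fun V X => stepValues v l V X ∪ stepValues v l' V X := by
  funext V X
  ext b
  simp only [stepValues, List.mem_append, Set.mem_ofPred_eq, Set.mem_union, or_and_right, exists_or]

/-- The property of being a solution depends only on the interpretation of the productions. -/
theorem IsAutomataSolution.congr {B : TreeGrammar ar N}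
    {inp : List (List (TreeAutomaton σ) × List (TreeAutomaton σ)) ×
      TreeGrammar (GSym.arity ar N) ℕ} {v : Term ar → β} (hv : IsCongr v)
    (hsat : ∀ T ∈ inp.1, ∀ As ⊆ T.1 ++ T.2,
      ∀ t t', v t = v t' → (AcceptedByAll B As t ↔ AcceptedByAll B As t'))
    {G G' : TreeGrammar ar N} (h : IsAutomataSolution B inp G) (hstart : G.start = G'.start)
    (hhead : G.prods.head?.map Prod.fst = G'.prods.head?.map Prod.fst)
    (hstep : stepValues v G.prods = stepValues v G'.prods) (henc : G'.enc ∈ inp.2.language) :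
    IsAutomataSolution B inp G' := by
  obtain ⟨h1, h2, -⟩ := h
  refine ⟨?_, fun T hT => ?_, henc⟩
  · rw [TreeGrammar.StartsOnTop, ← hhead, ← hstart]
    exact h1
  · have key := derives_values_congr (G := G.extend B) (H := G'.extend B) hv (by
      simp only [TreeGrammar.extend, stepValues_append, hstep])
    obtain ⟨d, ⟨e, he, hs⟩, hmin⟩ := h2 T hT
    have e1 : (G'.extend B).start = (G.extend B).start := hstart.symm
    refine ⟨d, ?_, fun e' he' ht => ?_⟩
    · obtain ⟨e', h3, h4⟩ := (Set.ext_iff.1 (key (d + 1) _) (v e)).1 ⟨e, he, rfl⟩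
      rw [e1]
      exact ⟨e', h3, (hsat T hT _ (List.Subset.refl _) _ _ h4).2 hs⟩
    · rw [e1] at he'
      obtain ⟨e, h3, h4⟩ := (Set.ext_iff.1 (key d _) (v e')).2 ⟨e', he', rfl⟩
      exact (hsat T hT _ (List.subset_append_right _ _) _ _ h4).1
        (hmin e h3 ((hsat T hT _ (List.subset_append_left _ _) _ _ h4).2 ht))

/-- The index of the congruence that saturates the set of solutions: `n` is the number of
nonterminals, and `k` and `m` are the indices of congruences for the examples and the
meta-grammar. -/
def solutionIndex (n k m : ℕ) : ℕ :=
  2 ^ ((2 ^ k) ^ ((2 ^ k) ^ n)) * 2 ^ ((n + 1) * ((2 ^ k) ^ n) ^ ((2 ^ k) ^ n)) * m * 2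

/-- The class of a tree consists of its two attributes, its class for the meta-grammar and one bit
for membership in the set of encoded solutions. The factors of `solutionIndex` count these four
components. -/
theorem exists_isCongr_solutions [Fintype N] (B : TreeGrammar ar N)
    (inp : List (List (TreeAutomaton σ) × List (TreeAutomaton σ)) ×
      TreeGrammar (GSym.arity ar N) ℕ) :
    ∃ v : GTree ar N → Fin (solutionIndex (Fintype.card N) (taskIndex B inp.1)
        (2 ^ TreeGrammar.rhsSize inp.2.wordProds)),
      IsCongr v ∧ Saturates v {t | ∃ G, IsAutomataSolution B inp G ∧ G.enc = t} := by
  classical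
  obtain ⟨v, hv, hsat⟩ := exists_isCongr_tasks B inp.1
  obtain ⟨m, hm, hmeta⟩ := inp.2.exists_isCongr
  let attr : GTree ar N → _ := fun t => ((formAttr v t, prodsAttr v t), m t)
  have hattr : IsCongr attr := (isCongr_attr v).prodMk hm
  let L : Set (GTree ar N) := {t | ∃ G, IsAutomataSolution B inp G ∧ G.enc = t}
  have hroot : ∀ {s : GSym σ N} {ts : Fin (GSym.arity ar N s) → GTree ar N},
      .node s ts ∈ L → s = .root := by
    rintro s ts ⟨G, -, h⟩
    rw [TreeGrammar.enc] at h
    cases h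
    rfl
  have hL : ∀ ts ts' : Fin 1 → GTree ar N, (∀ i, attr (ts i) = attr (ts' i)) →
      Term.node (ar := GSym.arity ar N) .root ts ∈ L →
      Term.node (ar := GSym.arity ar N) .root ts' ∈ L := by
    rintro ts ts' h ⟨G, hG, he⟩
    have hmem : m (.node .root ts) = m (.node .root ts') :=
      hm .root ts ts' fun i => (Prod.ext_iff.1 (h i)).2
    have h0 : prodsAttr v (ts 0) = prodsAttr v (ts' 0) :=
      (Prod.ext_iff.1 (Prod.ext_iff.1 (h 0)).1).2
    rw [TreeGrammar.enc] at he
    have he0 : encProds G.prods = ts 0 := by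
      cases he
      rfl
    -- Equal attributes make the other tree decodable too, to productions with the same operator and
    -- the same first nonterminal.
    obtain ⟨l, hl, hp⟩ := (Set.ext_iff.1 h0 _).1 ⟨G.prods, he0, rfl⟩
    have henc : (TreeGrammar.mk G.start l).enc = .node .root ts' := by
      refine congrArg (Term.node (ar := GSym.arity ar N) GSym.root)
        (?_ : ![encProds l] = ts')
      funext i
      rw [Fin.fin_one_eq_zero i]
      exact hl
    refine ⟨⟨G.start, l⟩, hG.congr hv hsat rfl (Prod.ext_iff.1 hp).1 (Prod.ext_iff.1 hp).2 ?_, henc⟩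
    rw [henc, TreeGrammar.mem_language_iff]
    refine (hmeta _ _ _ hmem).1 (TreeGrammar.mem_language_iff.1 ?_)
    rw [← he]
    exact hG.2.2
  -- The membership bit respects the congruence: at `root` it is determined by the attributes of the
  -- child, and below any other symbol it is false.
  have hfull : IsCongr fun t => (attr t, t ∈ L) := by
    intro s ts ts' h
    have h1 := fun i => (Prod.ext_iff.1 (h i)).1
    refine Prod.ext (hattr s ts ts' h1) (propext ?_)
    by_cases hs : s = .root
    · subst hs
      exact ⟨hL ts ts' h1, hL ts' ts fun i => (h1 i).symm⟩
    · exact ⟨fun h => absurd (hroot h) hs, fun h => absurd (hroot h) hs⟩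
  have hcard : Fintype.card ((((Set ((N → Set (Fin (taskIndex B inp.1))) →
      Set (Fin (taskIndex B inp.1)))) × Set (Option N × ((N → Set (Fin (taskIndex B inp.1))) →
        N → Set (Fin (taskIndex B inp.1))))) × Fin (2 ^ TreeGrammar.rhsSize inp.2.wordProds)) ×
        Prop) = solutionIndex (Fintype.card N) (taskIndex B inp.1)
        (2 ^ TreeGrammar.rhsSize inp.2.wordProds) := by
    simp only [Fintype.card_prod, Fintype.card_set, Fintype.card_fun, Fintype.card_fin,
      Fintype.card_option, Fintype.card_prop, solutionIndex]
  let φ := Fintype.equivFinOfCardEq hcard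
  exact ⟨fun t => φ (attr t, t ∈ L), hfull.comp_injective φ.injective,
    Saturates.comp_injective (fun t t' e => iff_of_eq (Prod.ext_iff.1 e).2) φ.injective⟩

theorem isRegularTreeSet_solutions [Finite σ] [Finite N] (B : TreeGrammar ar N)
    (inp : List (List (TreeAutomaton σ) × List (TreeAutomaton σ)) ×
      TreeGrammar (GSym.arity ar N) ℕ) :
    IsRegularTreeSet {t | ∃ G, IsAutomataSolution B inp G ∧ G.enc = t} := by
  have := Fintype.ofFinite N
  obtain ⟨v, hv, hL⟩ := exists_isCongr_solutions B inp
  exact isRegularTreeSet_of_isCongr hv hL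

/-- If there is a solution, then there is a small one. -/
theorem IsAutomataSolution.exists_small [Fintype N] {B : TreeGrammar ar N}
    {inp : List (List (TreeAutomaton σ) × List (TreeAutomaton σ)) ×
      TreeGrammar (GSym.arity ar N) ℕ} {r : ℕ} (hr : ∀ s, GSym.arity ar N s ≤ r)
    {G : TreeGrammar ar N} (h : IsAutomataSolution B inp G) :
    ∃ G', IsAutomataSolution B inp G' ∧ G'.enc.toWord.length ≤
      Term.sizeBound r (solutionIndex (Fintype.card N) (taskIndex B inp.1)
        (2 ^ TreeGrammar.rhsSize inp.2.wordProds)) := by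
  obtain ⟨v, hv, hL⟩ := exists_isCongr_solutions B inp
  obtain ⟨t, h1, h2⟩ := Term.exists_heightLE_of_isCongr hv G.enc
  obtain ⟨G', h3, rfl⟩ := (hL _ _ h1).2 ⟨G, h, rfl⟩
  exact ⟨G', h3, h2.length_toWord_le hr⟩

/-! ### Polish notation of encoded grammars -/

/-- The encoding of symbols in right-hand sides. -/
def formSym : σ ⊕ N → GSym σ N :=
  Sum.elim .base .rhs

/-- The encoding of a grammar in Polish notation. -/
def encWord (P : List (N × List (σ ⊕ N))) : List (GSym σ N) :=
  .root :: (P.flatMap (fun p => .lhs p.1 :: p.2.map formSym) ++ [.fin])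

theorem toWord_encTerm (α : Term (withNullary ar N)) :
    (encTerm α).toWord = α.toWord.map formSym := by
  induction α using TreeGrammar.form_induction with
  | sym f αs ih =>
    have h1 : (Term.node (ar := withNullary ar N) (.inl f) αs).toWord =
      .inl f :: (List.ofFn fun i : Fin (ar f) => (αs i).toWord).flatten := rfl
    have h2 : (encTerm (.node (.inl f) αs)).toWord =
      .base f :: (List.ofFn fun i : Fin (ar f) => (encTerm (αs i)).toWord).flatten := rfl
    rw [h1, h2]
    simp only [ih, List.map_cons, List.map_flatten, List.map_ofFn]
    rfl
  | nonterminal X => rfl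

theorem toWord_enc (G : TreeGrammar ar N) : G.enc.toWord = encWord G.wordProds := by
  have h : ∀ l : List (N × Term (withNullary ar N)), (encProds l).toWord =
      (l.map fun p => (p.1, p.2.toWord)).flatMap
        (fun p => .lhs p.1 :: p.2.map formSym) ++ [.fin] := by
    intro l
    induction l with
    | nil => rfl
    | cons p l ih =>
      obtain ⟨X, α⟩ := p
      have : (encProds ((X, α) :: l)).toWord =
        .lhs X :: ((encTerm α).toWord ++ ((encProds l).toWord ++ [])) := by
        simp only [encProds, Term.toWord]
        rfl
      rw [this, ih, toWord_encTerm]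
      simp
  have h' : G.enc.toWord = .root :: ((encProds G.prods).toWord ++ []) := by
    simp only [TreeGrammar.enc, Term.toWord]
    rfl
  rw [h', h, List.append_nil]
  rfl

end GrammarTrees

/-! ### Algorithms -/

section Quantifiers

variable {γ : Type u} {α : Type v} [Primcodable γ] [Primcodable α] {R : γ → α → Prop}

theorem primrecPred_exists_mem {l : γ → List α} (hl : Primrec l)
    (hR : PrimrecPred fun p : γ × α => R p.1 p.2) : PrimrecPred fun c => ∃ a ∈ l c, R c a :=
  (PrimrecRel.exists_mem_list (R := fun a c => R c a)
    (hR.comp (Primrec.snd.pair Primrec.fst))).comp hl Primrec.id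

theorem primrecPred_forall_mem {l : γ → List α} (hl : Primrec l)
    (hR : PrimrecPred fun p : γ × α => R p.1 p.2) : PrimrecPred fun c => ∀ a ∈ l c, R c a :=
  (PrimrecRel.forall_mem_list (R := fun a c => R c a)
    (hR.comp (Primrec.snd.pair Primrec.fst))).comp hl Primrec.id

theorem primrecPred_exists_lt {R : γ → ℕ → Prop} {n : γ → ℕ} (hn : Primrec n)
    (hR : PrimrecPred fun p : γ × ℕ => R p.1 p.2) : PrimrecPred fun c => ∃ a < n c, R c a :=
  (primrecPred_exists_mem (Primrec.list_range.comp hn) hR).of_eq fun c => by simp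

theorem primrecPred_imp {p q : γ → Prop} (hp : PrimrecPred p) (hq : PrimrecPred q) :
    PrimrecPred fun c => p c → q c :=
  (hp.not.or hq).of_eq fun _ => imp_iff_not_or.symm

/-- Searching a list for an element with a primitive recursive property. -/
theorem exists_primrec_search {l : γ → List α} (hR : PrimrecPred fun p : γ × α => R p.1 p.2)
    (hl : Primrec l) : ∃ s : γ → Option α, Primrec s ∧ ∀ c, (∀ a, s c = some a → R c a) ∧
      (s c = none → ∀ a ∈ l c, ¬ R c a) := by
  classical
  have hf : Primrec fun c => (l c).filterMap fun a => if R c a then some a else none :=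
    Primrec.listFilterMap hl (Primrec.ite hR (Primrec.option_some.comp Primrec.snd)
      (Primrec.const none))
  have hmem : ∀ c a, a ∈ ((l c).filterMap fun a => if R c a then some a else none) ↔
      a ∈ l c ∧ R c a := by
    intro c a
    simp only [List.mem_filterMap, Option.ite_none_right_eq_some, Option.some.injEq]
    exact ⟨fun ⟨_, h1, h2, h3⟩ => h3 ▸ ⟨h1, h2⟩, fun h => ⟨a, h.1, h.2, rfl⟩⟩
  refine ⟨_, Primrec.list_head?.comp hf, fun c => ⟨fun a ha => ?_, fun hn a ha hR => ?_⟩⟩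
  · exact ((hmem c a).1 (List.mem_of_head? ha)).2
  · have h3 := (hmem c a).2 ⟨ha, hR⟩
    rw [List.head?_eq_none_iff.1 hn] at h3
    exact List.not_mem_nil h3

end Quantifiers

/-- Recursion on the length of the processed prefix. It is needed because the automata depend on the
examples only in a `Computable` way. -/
theorem computable_list_map {α : Type u} {β : Type v} [Primcodable α] [Primcodable β] {f : α → β}
    (hf : Computable f) : Computable fun l : List α => l.map f := by
  have h : Computable fun l : List α => (Nat.rec [] (fun n acc =>
      acc ++ ((l[n]?.map f).elim [] fun b => [b])) l.length : List β) := by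
    refine Computable.nat_rec Computable.list_length (Computable.const ([] : List β))
      (h := fun l p => p.2 ++ ((l[p.1]?.map f).elim [] fun b => [b])) ?_
    refine Computable.list_append.comp (Computable.snd.comp Computable.snd) ?_
    have h1 : Computable fun p : List α × ℕ × List β => (p.1[p.2.1]?).map f :=
      Computable.option_map (Computable.list_getElem?.comp Computable.fst
        (Computable.fst.comp Computable.snd)) (hf.comp Computable.snd).to₂
    have h2 : Primrec fun o : Option β => (o.elim [] fun b => [b] : List β) :=
      (Primrec.option_casesOn Primrec.id (Primrec.const [])
        (Primrec.list_cons.comp Primrec.snd (Primrec.const [])).to₂).of_eq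
        fun o => by cases o <;> rfl
    exact h2.to_comp.comp h1
  refine h.of_eq fun l => ?_
  have : ∀ n ≤ l.length, (Nat.rec [] (fun n acc =>
      acc ++ ((l[n]?.map f).elim [] fun b => [b])) n : List β) = (l.take n).map f := by
    intro n
    induction n with
    | zero => simp
    | succ n ih =>
      intro hn
      have hn' : n < l.length := hn
      simp only [ih (by omega)]
      rw [List.take_succ_eq_append_getElem hn']
      rw [List.map_append, List.getElem?_eq_getElem hn']
      rfl
  rw [this _ le_rfl, List.take_length]

/-! ### Primitive recursiveness of the operations on terms, automata and grammars -/

section Codes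

variable {σ : Type u} [Primcodable σ] {ar : σ → ℕ} {ν : Type v} [Primcodable ν]

theorem primrec_toWord [PrimArity ar] : Primrec (Term.toWord (ar := ar)) := by
  let := Primcodable.subtype (Term.primrecPred_stackSize (PrimArity.out (ar := ar)))
  exact Primrec.subtype_val.comp (Primrec.of_equiv (e := Term.wordEquiv ar))

/-- Terms can be recovered from their Polish notation by a primitive recursive function. -/
theorem exists_primrec_ofWord [PrimArity ar] : ∃ g : List σ → Option (Term ar), Primrec g ∧
    ∀ t, g t.toWord = some t :=
  ⟨fun w => Encodable.decode (Encodable.encode w), Primrec.decode.comp Primrec.encode,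
    fun t => Encodable.encodek t⟩

theorem primrec_init : Primrec (TreeAutomaton.init (σ := σ)) :=
  Primrec.fst.comp (Primrec.of_equiv (e := TreeAutomaton.equivProd σ))

theorem primrec_trans : Primrec (TreeAutomaton.trans (σ := σ)) :=
  Primrec.snd.comp (Primrec.of_equiv (e := TreeAutomaton.equivProd σ))

theorem primrec_start [PrimArity ar] : Primrec (TreeGrammar.start (ar := ar) (ν := ν)) :=
  Primrec.fst.comp (Primrec.of_equiv (e := TreeGrammar.equivProd ar ν))

theorem primrec_prods [PrimArity ar] : Primrec (TreeGrammar.prods (ar := ar) (ν := ν)) :=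
  Primrec.snd.comp (Primrec.of_equiv (e := TreeGrammar.equivProd ar ν))

theorem primrec_mk [PrimArity ar] : Primrec fun p : ν × List (ν × Term (withNullary ar ν)) =>
    TreeGrammar.mk p.1 p.2 :=
  Primrec.of_equiv_symm (e := TreeGrammar.equivProd ar ν)

theorem primrec_wordProds [PrimArity ar] :
    Primrec (TreeGrammar.wordProds (ar := ar) (ν := ν)) :=
  Primrec.list_map primrec_prods ((Primrec.fst.comp Primrec.snd).pair
    (primrec_toWord.comp (Primrec.snd.comp Primrec.snd))).to₂

theorem primrec_rhsSize : Primrec (TreeGrammar.rhsSize (σ := σ) (ν := ν)) :=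
  Primrec.list_length.comp (Primrec.list_flatMap Primrec.id (Primrec.snd.comp Primrec.snd).to₂)

theorem primrec_automaton_wordProds [PrimArity ar] :
    Primrec (TreeAutomaton.wordProds (σ := σ) ar) := by
  refine Primrec.listFilterMap primrec_trans ?_
  have hp : Primrec fun q : TreeAutomaton σ × ℕ × σ × List ℕ => q.2 := Primrec.snd
  have hf : Primrec fun q : TreeAutomaton σ × ℕ × σ × List ℕ => q.2.2.1 :=
    Primrec.fst.comp (Primrec.snd.comp hp)
  have hl : Primrec fun q : TreeAutomaton σ × ℕ × σ × List ℕ => q.2.2.2 :=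
    Primrec.snd.comp (Primrec.snd.comp hp)
  refine Primrec.ite (Primrec.eq.comp (Primrec.list_length.comp hl)
    ((PrimArity.out (ar := ar)).comp hf)) ?_ (Primrec.const none)
  refine Primrec.option_some.comp ((Primrec.fst.comp hp).pair (Primrec.list_cons.comp
    (Primrec.sumInl.comp hf) (Primrec.list_map hl (Primrec.sumInr.comp Primrec.snd).to₂)))

theorem primrec_substWord [DecidableEq ν] : Primrec₂ (substWord (σ := σ) (ν := ν)) := by
  let C := (List (ν × List σ) × List (σ ⊕ ν)) × (σ ⊕ ν) × List (List σ)
  have hL : Primrec fun q : C => q.2.2 := Primrec.snd.comp Primrec.snd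
  have h1 : Primrec₂ fun (q : C) (f : σ) => q.2.2.map (f :: ·) :=
    Primrec.list_map (hL.comp Primrec.fst)
      (Primrec.list_cons.comp (Primrec.snd.comp Primrec.fst) Primrec.snd).to₂
  have h2 : Primrec₂ fun (q : C) (X : ν) =>
      q.1.1.flatMap fun p => if p.1 = X then q.2.2.map (p.2 ++ ·) else [] := by
    refine Primrec.list_flatMap (Primrec.fst.comp (Primrec.fst.comp Primrec.fst)) ?_
    refine Primrec.ite (Primrec.eq.comp (Primrec.fst.comp Primrec.snd)
      (Primrec.snd.comp Primrec.fst)) ?_ (Primrec.const [])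
    exact Primrec.list_map (hL.comp (Primrec.fst.comp Primrec.fst))
      (Primrec.list_append.comp (Primrec.snd.comp (Primrec.snd.comp Primrec.fst))
        Primrec.snd).to₂
  have h3 : Primrec fun q : C => (q.2.1.elim (fun f => q.2.2.map (f :: ·))
      fun X => q.1.1.flatMap fun p => if p.1 = X then q.2.2.map (p.2 ++ ·) else []) :=
    (Primrec.sumCasesOn (Primrec.fst.comp Primrec.snd) h1 h2).of_eq
      fun ⟨_, s, _⟩ => by cases s <;> rfl
  exact Primrec.list_foldr (f := Prod.snd) (g := fun _ => [[]])
    (h := fun (p : List (ν × List σ) × List (σ ⊕ ν)) (q : (σ ⊕ ν) × List (List σ)) =>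
      q.1.elim (fun f => q.2.map (f :: ·))
        fun X => p.1.flatMap fun (p : ν × List σ) => if p.1 = X then q.2.map (p.2 ++ ·) else [])
    Primrec.snd (Primrec.const _) h3

theorem primrec_derivableWords [DecidableEq ν] :
    Primrec₂ (derivableWords (σ := σ) (ν := ν)) := by
  have h : Primrec fun p : List (ν × List (σ ⊕ ν)) × ℕ =>
      (Nat.rec [] (fun _ E => p.1.flatMap fun q => (substWord E q.2).map (Prod.mk q.1))
        p.2 : List (ν × List σ)) := by
    refine Primrec.nat_rec' Primrec.snd (Primrec.const ([] : List (ν × List σ)))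
      (h := fun (p : List (ν × List (σ ⊕ ν)) × ℕ) (n : ℕ × List (ν × List σ)) =>
        p.1.flatMap fun q => (substWord n.2 q.2).map (Prod.mk q.1)) ?_
    refine Primrec.list_flatMap (Primrec.fst.comp Primrec.fst) ?_
    refine Primrec.list_map (primrec_substWord.comp
      (Primrec.snd.comp (Primrec.snd.comp Primrec.fst)) (Primrec.snd.comp Primrec.snd)) ?_
    exact ((Primrec.fst.comp (Primrec.snd.comp Primrec.fst)).pair Primrec.snd).to₂
  refine h.of_eq fun ⟨P, d⟩ => ?_
  induction d with
  | zero => rfl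
  | succ d ih =>
    simp only [derivableWords] at ih ⊢
    rw [← ih]

theorem primrecPred_wordDerivable [DecidableEq ν] :
    PrimrecPred fun p : List (ν × List (σ ⊕ ν)) × ν × List σ =>
      WordDerivable p.1 p.2.1 p.2.2 := by
  have h : Primrec fun p : List (ν × List (σ ⊕ ν)) × ν × List σ =>
      derivableWords p.1 (p.1.length * (p.2.2.length + 1)) :=
    primrec_derivableWords.comp Primrec.fst (Primrec.nat_mul.comp
      (Primrec.list_length.comp Primrec.fst)
      (Primrec.succ.comp (Primrec.list_length.comp (Primrec.snd.comp Primrec.snd))))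
  refine (primrecPred_exists_mem (R := fun p a => a = p.2) h
    (Primrec.eq.comp Primrec.snd (Primrec.snd.comp Primrec.fst))).of_eq fun p => ?_
  simp [WordDerivable]

end Codes

/-! ### Computable bounds and enumeration of words -/

section Bounds

theorem primrec₂_pow : Primrec₂ ((· ^ ·) : ℕ → ℕ → ℕ) :=
  Primrec₂.unpaired'.1 Nat.Primrec.pow

theorem primrec_solutionIndex (n : ℕ) :
    Primrec fun p : ℕ × ℕ => solutionIndex n p.1 p.2 := by
  have h2 : Primrec fun p : ℕ × ℕ => 2 ^ p.1 := primrec₂_pow.comp (Primrec.const 2) Primrec.fst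
  have hn : Primrec fun p : ℕ × ℕ => (2 ^ p.1) ^ n := primrec₂_pow.comp h2 (Primrec.const n)
  refine Primrec.nat_mul.comp (Primrec.nat_mul.comp (Primrec.nat_mul.comp
    (primrec₂_pow.comp (Primrec.const 2) (primrec₂_pow.comp h2 hn))
    (primrec₂_pow.comp (Primrec.const 2) (Primrec.nat_mul.comp (Primrec.const (n + 1))
      (primrec₂_pow.comp hn hn)))) Primrec.snd) (Primrec.const 2)

theorem primrec_sizeBound (r : ℕ) : Primrec (Term.sizeBound r) := by
  have h : Primrec (Nat.rec 0 (fun _ s => r * s + 1) : ℕ → ℕ) :=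
    Primrec.nat_rec₁ 0 (Primrec.succ.comp (Primrec.nat_mul.comp (Primrec.const r) Primrec.snd)).to₂
  refine h.of_eq fun n => ?_
  induction n with
  | zero => rfl
  | succ n ih =>
    simp only [Term.sizeBound]
    rw [← ih]

/-- The words of bounded length over a finite alphabet. -/
def wordsUpTo {α : Type u} (s : List α) : ℕ → List (List α)
  | 0 => [[]]
  | n + 1 => [] :: (wordsUpTo s n).flatMap fun w => s.map (· :: w)

theorem mem_wordsUpTo {α : Type u} {s : List α} {n : ℕ} {w : List α} (hw : ∀ a ∈ w, a ∈ s)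
    (hn : w.length ≤ n) : w ∈ wordsUpTo s n := by
  induction n generalizing w with
  | zero =>
    obtain rfl := List.length_eq_zero_iff.1 (Nat.le_zero.1 hn)
    simp [wordsUpTo]
  | succ n ih =>
    cases w with
    | nil => simp [wordsUpTo]
    | cons a w =>
      simp only [List.mem_cons, forall_eq_or_imp, List.length_cons, Nat.succ_le_succ_iff] at hw hn
      simp only [wordsUpTo, List.mem_cons, List.mem_flatMap, List.mem_map]
      exact Or.inr ⟨w, ih hw.2 hn, a, hw.1, rfl⟩

theorem primrec_wordsUpTo {α : Type u} [Primcodable α] : Primrec₂ (wordsUpTo (α := α)) := by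
  have h : Primrec fun p : List α × ℕ =>
      (Nat.rec [[]] (fun _ W => [] :: W.flatMap fun w => p.1.map (· :: w)) p.2 :
        List (List α)) := by
    refine Primrec.nat_rec' Primrec.snd (Primrec.const ([[]] : List (List α)))
      (h := fun (p : List α × ℕ) (n : ℕ × List (List α)) => [] :: n.2.flatMap fun w => p.1.map (· :: w)) ?_
    refine Primrec.list_cons.comp (Primrec.const [])
      (Primrec.list_flatMap (Primrec.snd.comp Primrec.snd) ?_)
    exact Primrec.list_map (Primrec.fst.comp (Primrec.fst.comp Primrec.fst))
      (Primrec.list_cons.comp Primrec.snd (Primrec.snd.comp Primrec.fst)).to₂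
  refine h.of_eq fun ⟨s, n⟩ => ?_
  induction n with
  | zero => rfl
  | succ n ih =>
    simp only [wordsUpTo] at ih ⊢
    rw [← ih]

end Bounds

/-! ### Testing and searching for solutions -/

section Decision

variable {σ : Type u} [Primcodable σ] [Finite σ] {ar : σ → ℕ} {N : Type v}

theorem primrec_taskIndex (B : TreeGrammar ar N) : Primrec (taskIndex B) := by
  have h : Primrec (taskProds ar) := Primrec.list_flatMap Primrec.id
    (Primrec.list_flatMap (Primrec.list_append.comp (Primrec.fst.comp Primrec.snd)
      (Primrec.snd.comp Primrec.snd)) (primrec_automaton_wordProds.comp Primrec.snd).to₂).to₂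
  exact primrec₂_pow.comp (Primrec.const 2) (Primrec.nat_add.comp (Primrec.const _)
    (primrec_rhsSize.comp h))

variable [Primcodable N]

/-- `AcceptedByAll` for terms in Polish notation. -/
theorem exists_primrecPred_acceptedByAll (B : TreeGrammar ar N) :
    ∃ p : List (TreeAutomaton σ) × List σ → Prop, PrimrecPred p ∧
      ∀ (As : List (TreeAutomaton σ)) (e : Term ar), p (As, e.toWord) ↔ AcceptedByAll B As e := by
  classical
  refine ⟨fun p => WordDerivable B.wordProds B.start p.2 ∧ ∀ A ∈ p.1, ∃ q ∈ A.init,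
    WordDerivable (A.wordProds ar) q p.2, ?_, fun As e => ?_⟩
  · refine PrimrecPred.and (primrecPred_wordDerivable.comp
      ((Primrec.const _).pair ((Primrec.const _).pair Primrec.snd))) ?_
    refine primrecPred_forall_mem
      (R := fun (p : List (TreeAutomaton σ) × List σ) (A : TreeAutomaton σ) => ∃ q ∈ A.init,
      WordDerivable (A.wordProds ar) q p.2) Primrec.fst ?_
    refine primrecPred_exists_mem (R := fun (p : (List (TreeAutomaton σ) × List σ) ×
      TreeAutomaton σ) q => WordDerivable (p.2.wordProds ar) q p.1.2)
      (primrec_init.comp Primrec.snd) ?_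
    exact primrecPred_wordDerivable.comp ((primrec_automaton_wordProds.comp
      (Primrec.snd.comp Primrec.fst)).pair (Primrec.snd.pair
      (Primrec.snd.comp (Primrec.fst.comp Primrec.fst))))
  · simp only [wordDerivable_iff, ← TreeAutomaton.mem_language_iff,
      ← TreeGrammar.mem_language_iff]
    rfl

/-- Only finitely many expressions are derivable at a given depth, so both quantifiers over
expressions run through the lists `derivableWords`. -/
theorem primrecPred_generalizesAt (B : TreeGrammar ar N) {C : Type w} [Primcodable C]
    {G : C → TreeGrammar ar N} {T : C → List (TreeAutomaton σ) × List (TreeAutomaton σ)} {d : C → ℕ}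
    (hG : Primrec G) (hT : Primrec T) (hd : Primrec d) :
    PrimrecPred fun c => GeneralizesAt B ((G c).extend B) (T c) (d c) := by
  classical
  obtain ⟨acc, hacc, haccB⟩ := exists_primrecPred_acceptedByAll B
  have hP : Primrec fun c => ((G c).extend B).wordProds :=
    (Primrec.list_append.comp (primrec_wordProds.comp hG) (Primrec.const B.wordProds)).of_eq
      fun c => by simp [TreeGrammar.wordProds, TreeGrammar.extend]
  have hE1 : Primrec fun c => derivableWords ((G c).extend B).wordProds (d c + 1) :=
    primrec_derivableWords.comp hP (Primrec.succ.comp hd)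
  have hE : Primrec fun c => derivableWords ((G c).extend B).wordProds (d c) :=
    primrec_derivableWords.comp hP hd
  have hstart : PrimrecPred fun q : C × N × List σ => q.2.1 = (G q.1).start :=
    Primrec.eq.comp (Primrec.fst.comp Primrec.snd) (primrec_start.comp (hG.comp Primrec.fst))
  have hw : Primrec fun q : C × N × List σ => q.2.2 := Primrec.snd.comp Primrec.snd
  have hT1 : Primrec fun q : C × N × List σ => (T q.1).1 :=
    Primrec.fst.comp (hT.comp Primrec.fst)
  have hT2 : Primrec fun q : C × N × List σ => (T q.1).2 :=
    Primrec.snd.comp (hT.comp Primrec.fst)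
  have h1 : PrimrecPred fun c => ∃ q ∈ derivableWords ((G c).extend B).wordProds (d c + 1),
      q.1 = (G c).start ∧ acc ((T c).1 ++ (T c).2, q.2) :=
    primrecPred_exists_mem (R := fun c q => q.1 = (G c).start ∧ acc ((T c).1 ++ (T c).2, q.2)) hE1
      (hstart.and (hacc.comp ((Primrec.list_append.comp hT1 hT2).pair hw)))
  have h2 : PrimrecPred fun c => ∀ q ∈ derivableWords ((G c).extend B).wordProds (d c),
      q.1 = (G c).start → acc ((T c).1, q.2) → acc ((T c).2, q.2) :=
    primrecPred_forall_mem (R := fun c q => q.1 = (G c).start → acc ((T c).1, q.2) →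
      acc ((T c).2, q.2)) hE (primrecPred_imp hstart (primrecPred_imp
        (hacc.comp (hT1.pair hw)) (hacc.comp (hT2.pair hw))))
  refine (h1.and h2).of_eq fun c => and_congr ?_ ?_
  · constructor
    · rintro ⟨⟨X, w⟩, hq, rfl, ha⟩
      obtain ⟨e, rfl, he⟩ := mem_derivableWords_iff.1 hq
      exact ⟨e, he, (haccB _ _).1 ha⟩
    · rintro ⟨e, he, ha⟩
      exact ⟨((G c).start, e.toWord), mem_derivableWords_iff.2 ⟨e, rfl, he⟩, rfl, (haccB _ _).2 ha⟩
  · constructor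
    · intro h e he ha
      exact (haccB _ _).1 (h ((G c).start, e.toWord) (mem_derivableWords_iff.2 ⟨e, rfl, he⟩) rfl
        ((haccB _ _).2 ha))
    · rintro h ⟨X, w⟩ hq rfl ha
      obtain ⟨e, rfl, he⟩ := mem_derivableWords_iff.1 hq
      exact (haccB _ _).2 (h e he ((haccB _ _).1 ha))

theorem primrec_encWord [Finite N] : Primrec (encWord (σ := σ) (N := N)) := by
  have h1 : Primrec (formSym (σ := σ) (N := N)) := Primrec.dom_finite _
  have h2 : Primrec (GSym.lhs : N → GSym σ N) := Primrec.dom_finite _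
  refine Primrec.list_cons.comp (Primrec.const _) (Primrec.list_append.comp
    (Primrec.list_flatMap Primrec.id ?_) (Primrec.const _))
  exact (Primrec.list_cons.comp (h2.comp (Primrec.fst.comp Primrec.snd))
    (Primrec.list_map (Primrec.snd.comp Primrec.snd) (h1.comp Primrec.snd).to₂)).to₂

theorem primrecPred_isAutomataSolution [Finite N] (B : TreeGrammar ar N) :
    PrimrecPred fun p : (List (List (TreeAutomaton σ) × List (TreeAutomaton σ)) ×
      TreeGrammar (GSym.arity ar N) ℕ) × TreeGrammar ar N => IsAutomataSolution B p.1 p.2 := by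
  classical
  let C := (List (List (TreeAutomaton σ) × List (TreeAutomaton σ)) ×
      TreeGrammar (GSym.arity ar N) ℕ) × TreeGrammar ar N
  have hG : Primrec fun p : C => p.2 := Primrec.snd
  have hM : Primrec fun p : C => p.1.2 := Primrec.snd.comp Primrec.fst
  have h1 : PrimrecPred fun p : C => p.2.StartsOnTop :=
    Primrec.eq.comp (Primrec.option_map (Primrec.list_head?.comp (primrec_prods.comp hG))
      (Primrec.fst.comp Primrec.snd).to₂) (Primrec.option_some.comp (primrec_start.comp hG))
  -- The unbounded search for `d` is replaced by the bounded one of `exists_generalizesAt_iff`.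
  have h2 : PrimrecPred fun p : C => ∀ T ∈ p.1.1,
      ∃ d < (p.2.extend B).prods.length * taskIndex B p.1.1,
        GeneralizesAt B (p.2.extend B) T d := by
    refine primrecPred_forall_mem (R := fun (p : C) T =>
      ∃ d < (p.2.extend B).prods.length * taskIndex B p.1.1,
        GeneralizesAt B (p.2.extend B) T d) (Primrec.fst.comp Primrec.fst) ?_
    refine primrecPred_exists_lt (γ := C × _) (R := fun q d =>
      GeneralizesAt B (q.1.2.extend B) q.2 d) ?_ ?_
    · refine Primrec.nat_mul.comp ?_
        ((primrec_taskIndex B).comp (Primrec.fst.comp (Primrec.fst.comp Primrec.fst)))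
      exact Primrec.list_length.comp (Primrec.list_append.comp
        (primrec_prods.comp (hG.comp Primrec.fst)) (Primrec.const _))
    · exact primrecPred_generalizesAt B (hG.comp (Primrec.fst.comp Primrec.fst))
        (Primrec.snd.comp Primrec.fst) Primrec.snd
  have h3 : PrimrecPred fun p : C =>
      WordDerivable p.1.2.wordProds p.1.2.start (encWord p.2.wordProds) :=
    primrecPred_wordDerivable.comp ((primrec_wordProds.comp hM).pair
      ((primrec_start.comp hM).pair (primrec_encWord.comp (primrec_wordProds.comp hG))))
  refine (h1.and (h2.and h3)).of_eq fun ⟨inp, G⟩ => ?_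
  simp only [IsAutomataSolution, TreeGrammar.mem_language_iff, ← toWord_enc, wordDerivable_iff]
  refine and_congr_right fun _ => and_congr_left fun _ => ?_
  exact forall₂_congr fun T hT => (exists_generalizesAt_iff hT).symm

/-- All grammars with small encodings can be listed. -/
theorem exists_primrec_grammars [Finite N] (ar : σ → ℕ) :
    ∃ g : ℕ → List (TreeGrammar ar N), Primrec g ∧
      ∀ (n : ℕ) (G : TreeGrammar ar N), G.enc.toWord.length ≤ n → G ∈ g n := by
  classical
  have := Fintype.ofFinite σ
  have := Fintype.ofFinite N
  obtain ⟨f, hf, hft⟩ := exists_primrec_ofWord (ar := withNullary ar N)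
  let s : List (σ ⊕ N) := Finset.univ.toList
  let m : List N := Finset.univ.toList
  let forms : ℕ → List (Term (withNullary ar N)) := fun n => (wordsUpTo s n).filterMap f
  let rules : ℕ → List (N × Term (withNullary ar N)) := fun n =>
    m.flatMap fun X => (forms n).map (Prod.mk X)
  have hforms : Primrec forms := Primrec.listFilterMap
    (primrec_wordsUpTo.comp (Primrec.const s) Primrec.id) (hf.comp Primrec.snd).to₂
  have hrules : Primrec rules := Primrec.list_flatMap (Primrec.const m)
    (Primrec.list_map (hforms.comp Primrec.fst)
      ((Primrec.snd.comp Primrec.fst).pair Primrec.snd).to₂).to₂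
  refine ⟨fun n => m.flatMap fun X => (wordsUpTo (rules n) n).map (TreeGrammar.mk X), ?_, ?_⟩
  · refine Primrec.list_flatMap (Primrec.const m) ?_
    refine Primrec.list_map (primrec_wordsUpTo.comp (hrules.comp Primrec.fst) Primrec.fst) ?_
    exact (primrec_mk.comp ((Primrec.snd.comp Primrec.fst).pair Primrec.snd)).to₂
  · rintro n ⟨X, l⟩ hn
    rw [toWord_enc] at hn
    -- Every production contributes its left-hand symbol and its whole right-hand side to the
    -- encoding, so `n` bounds both the number of productions and the length of each right-hand
    -- side.
    have hlen : ∀ l : List (N × Term (withNullary ar N)), l.length ≤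
        ((l.map fun p => (p.1, p.2.toWord)).flatMap
          fun p => GSym.lhs p.1 :: p.2.map (formSym (σ := σ))).length ∧
        ∀ p ∈ l, p.2.toWord.length ≤ ((l.map fun p => (p.1, p.2.toWord)).flatMap
          fun p => GSym.lhs p.1 :: p.2.map (formSym (σ := σ))).length := by
      intro l
      induction l with
      | nil => simp
      | cons p l ih =>
        simp only [List.length_cons, List.map_cons, List.flatMap_cons, List.length_append,
          List.length_map, List.mem_cons, forall_eq_or_imp]
        refine ⟨by omega, by omega, fun q hq => ?_⟩
        have := ih.2 q hq
        omega
    simp only [encWord, TreeGrammar.wordProds, List.length_cons, List.length_append] at hn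
    have hl := hlen l
    simp only [List.mem_flatMap, List.mem_map]
    refine ⟨X, Finset.mem_toList.2 (Finset.mem_univ X), l, mem_wordsUpTo ?_ (by omega), rfl⟩
    rintro ⟨Y, α⟩ hp
    have h1 := hl.2 _ hp
    simp only at h1
    simp only [rules, forms, List.mem_flatMap, List.mem_map, List.mem_filterMap]
    exact ⟨Y, Finset.mem_toList.2 (Finset.mem_univ Y), α, ⟨α.toWord,
      mem_wordsUpTo (fun a _ => Finset.mem_toList.2 (Finset.mem_univ a)) (by omega), hft α⟩, rfl⟩

/-- DSL synthesis for examples that are given by tree automata. -/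
theorem exists_primrec_synthesis [Finite N] (B : TreeGrammar ar N) :
    ∃ synth : List (List (TreeAutomaton σ) × List (TreeAutomaton σ)) ×
      TreeGrammar (GSym.arity ar N) ℕ → Option (TreeGrammar ar N), Primrec synth ∧
      ∀ inp, (∀ G, synth inp = some G → IsAutomataSolution B inp G) ∧
        (synth inp = none → ¬ ∃ G, IsAutomataSolution B inp G) := by
  classical
  have := Fintype.ofFinite N
  obtain ⟨g, hg, hgG⟩ := exists_primrec_grammars (N := N) ar
  obtain ⟨r, hr⟩ : ∃ r, ∀ s, GSym.arity ar N s ≤ r := by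
    obtain ⟨r, hr⟩ := (Set.finite_range (GSym.arity ar N)).bddAbove
    exact ⟨r, fun s => hr ⟨s, rfl⟩⟩
  have h1 : Primrec fun inp : List (List (TreeAutomaton σ) × List (TreeAutomaton σ)) ×
      TreeGrammar (GSym.arity ar N) ℕ => taskIndex B inp.1 :=
    (primrec_taskIndex B).comp Primrec.fst
  have h2 : Primrec fun inp : List (List (TreeAutomaton σ) × List (TreeAutomaton σ)) ×
      TreeGrammar (GSym.arity ar N) ℕ => 2 ^ TreeGrammar.rhsSize inp.2.wordProds :=
    primrec₂_pow.comp (Primrec.const 2)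
      (primrec_rhsSize.comp (primrec_wordProds.comp Primrec.snd))
  have hbound := (primrec_sizeBound r).comp
    ((primrec_solutionIndex (Fintype.card N)).comp (h1.pair h2))
  obtain ⟨synth, hs, hspec⟩ := exists_primrec_search (primrecPred_isAutomataSolution B)
    (hg.comp hbound)
  refine ⟨synth, hs, fun inp => ⟨(hspec inp).1, fun hnone ⟨G, hG⟩ => ?_⟩⟩
  obtain ⟨G', h1, h2⟩ := hG.exists_small hr
  exact (hspec inp).2 hnone G' (hgG _ _ h2) h1

end Decision

end DSLSynth

/-! ### The main theorem: reduction from examples to automata -/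

open DSLSynth
theorem mainTheorem2 {Δ N M : Type*} [Primcodable Δ] [Finite Δ] [Primcodable N] [Finite N]
    [Primcodable M] (ar : Δ → ℕ) (B : BaseLanguage ar N M) (hB : B.TreeAutomatonComputable) :
    ComputablePred (fun inp : SynthesisInput ar N M => ∃ G, IsSolution B inp G) ∧
    (∃ synth : SynthesisInput ar N M → Option (TreeGrammar ar N), Computable synth ∧
      ∀ inp, (∀ G, synth inp = some G → IsSolution B inp G) ∧
        (synth inp = none → ¬ ∃ G, IsSolution B inp G)) ∧
    ∀ inp : SynthesisInput ar N M,
      IsRegularTreeSet {t : GTree ar N | ∃ G, IsSolution B inp G ∧ G.enc = t} := by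
  classical
  obtain ⟨A, _, hA, -, hAB⟩ := hB
  obtain ⟨synth, hs, hspec⟩ := exists_primrec_synthesis B.grammar
  let conv : SynthesisInput ar N M → List (List (TreeAutomaton Δ) × List (TreeAutomaton Δ)) ×
      TreeGrammar (GSym.arity ar N) ℕ :=
    fun inp => (inp.1.map fun I => (I.train.map A, I.test.map A), inp.2)
  have hI : Computable (LearningInstance.equivProd M) := Primrec.of_equiv.to_comp
  have hconv : Computable conv := by
    refine Computable.pair ((computable_list_map ?_).comp Computable.fst) Computable.snd
    exact ((computable_list_map hA).comp (Computable.fst.comp hI)).pair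
      ((computable_list_map hA).comp (Computable.snd.comp hI))
  have hiff : ∀ inp G, IsSolution B inp G ↔ IsAutomataSolution B.grammar (conv inp) G :=
    isSolution_iff fun m => (hAB m).1
  have hcomp : Computable fun inp => synth (conv inp) := hs.to_comp.comp hconv
  have hspec' : ∀ inp, (∀ G, synth (conv inp) = some G → IsSolution B inp G) ∧
      (synth (conv inp) = none → ¬ ∃ G, IsSolution B inp G) := by
    intro inp
    simp only [hiff]
    exact hspec (conv inp)
  refine ⟨⟨fun _ => Classical.dec _, ?_⟩, ⟨_, hcomp, hspec'⟩, fun inp => ?_⟩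
  -- The decision procedure runs the synthesizer and reports whether it returned a grammar.
  · refine (Primrec.option_isSome.to_comp.comp hcomp).of_eq fun inp => ?_
    obtain ⟨h1, h2⟩ := hspec' inp
    cases h : synth (conv inp) with
    | none => simpa using h2 h
    | some G => simpa using ⟨G, h1 G h⟩
  · simp only [hiff]
    exact isRegularTreeSet_solutions B.grammar (conv inp)
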